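/- Let $q$ be an odd prime power, let $d\ge 2$, and let $V$ be a $(2d+1)$-dimensional vector space over $\mathbb F_q$ with a nondegenerate quadratic form $\kappa$ and associated bilinear form $\beta(u,v)=\kappa(u+v)-\kappa(u)-\kappa(v)$. Let $\mathcal Q(2d,q)$ be the incidence structure whose points are the totally singular $1$-spaces of $V$ and whose maximals are the totally singular subspaces of largest dimension, incidence being inclusion. A \emph{hemisystem} is a set $H$ of maximals such that every point lies on exactly $(t+1)/2$ elements of $H$, where $t+1$ is the (constant) number of maximals on a point; that is, exactly half of the maximals on each point belong to $H$. A hemisystem $H$ \emph{admits} a group $G$ if $G$ is isomorphic to a subgroup of the stabiliser of $H$ in the automorphism group of the incidence structure $\mathcal Q(2d,q)$. For a quadratic space $X$, $\Omega(X)$ denotes the derived subgroup of the orthogonal group $\mathrm O(X)$. There exist vectors $z,e,f\in V$ such that $\kappa(z)\ne 0$, $\kappa(e)=\kappa(f)=0$, $\beta(e,f)=1$, $\beta(z,e)=\beta(z,f)=0$, and such that $U=W^\perp$ is of elliptic type, where $W=\langle z,e,f\rangle$ (that is, $\kappa|_U$ is nondegenerate of Witt index $\tfrac12\dim U-1=d-2$).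 For every such triple put \[ B=\{g\oplus 1_{U} : g\in\Omega(W,\kappa|_W)\}\le \mathrm O(V),\qquad A=\langle B,\tau\rangle , \] where $\tau\in\mathrm O(V)$ is the reflection with $\tau(z)=-z$ that fixes $z^\perp$ pointwise. Then: 1. $B\cong\Omega(W,\kappa|_W)=\Omega_3(q)$ and $B\cong\mathrm{PSL}_2(q)$; 2. $A$ and $B$ have the same orbits on points; 3. each $A$-orbit on maximals is the union of two distinct $B$-orbits; 4. if $n$ is the number of orbits of $A$ on the maximals, then there exist $2^n$ distinct hemisystems of $\mathcal Q(2d,q)$ that are invariant under $B$ and admit $B\cong\Omega_3(q)\cong\mathrm{PSL}_2(q)$. -/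

import Mathlib

/-! ### Incidence structures, hemisystems and automorphisms -/

section Incidence

variable {P M : Type*}

/-- Order `(s, t)`: `s + 1` points on every maximal and `t + 1` maximals on every point. -/
def HasOrder (I : P → M → Prop) (s t : ℕ) : Prop :=
  (∀ m, Nat.card {p // I p m} = s + 1) ∧ ∀ p, Nat.card {m // I p m} = t + 1

/-- A hemisystem of an incidence structure of order `(s, t)`: every point is incident with
exactly `(t + 1) / 2` maximals of `H`. -/
def IsHemisystem (I : P → M → Prop) (H : Set M) : Prop :=
  ∃ s t, HasOrder I s t ∧ ∀ p, 2 * Nat.card {m // m ∈ H ∧ I p m} = t + 1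

/-- The automorphism group of an incidence structure. -/
def incidenceAut (I : P → M → Prop) : Subgroup (Equiv.Perm P × Equiv.Perm M) where
  carrier := {g | ∀ p m, I (g.1 p) (g.2 m) ↔ I p m}
  one_mem' := by intro p m; rfl
  mul_mem' := by
    intro a b ha hb p m
    exact (ha _ _).trans (hb _ _)
  inv_mem' := by
    intro a ha p m
    have := ha (a.1⁻¹ p) (a.2⁻¹ m)
    simpa using this.symm

/-- The stabiliser of a set `H` of maximals in the automorphism group. -/
def incidenceStab (I : P → M → Prop) (H : Set M) : Subgroup (incidenceAut I) where
  carrier := {g | ∀ m, g.1.2 m ∈ H ↔ m ∈ H}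
  one_mem' := by intro m; rfl
  mul_mem' := by
    intro a b ha hb m
    exact (ha _).trans (hb _)
  inv_mem' := by
    intro a ha m
    have := ha (a.1.2⁻¹ m)
    simpa using this.symm

/-- `H` admits the group `G`: `G` is isomorphic to a subgroup of the stabiliser of `H` in the
automorphism group. -/
def Admits (I : P → M → Prop) (H : Set M) (G : Type*) [Group G] : Prop :=
  ∃ K : Subgroup (incidenceAut I), K ≤ incidenceStab I H ∧ Nonempty (G ≃* K)

end Incidence

/-! ### Quadratic forms and quadrics -/

section Quadric

variable {F V : Type*} [Field F] [AddCommGroup V] [Module F V]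

/-- Nondegenerate: the associated bilinear form `Q (u + v) - Q u - Q v` is nondegenerate. -/
def IsNondegenerate (Q : QuadraticForm F V) : Prop :=
  ∀ v, (∀ u, QuadraticMap.polar Q u v = 0) → v = 0

def IsTotallySingular (Q : QuadraticForm F V) (N : Submodule F V) : Prop :=
  ∀ v ∈ N, Q v = 0

/-- The largest dimension of a totally singular subspace. -/
noncomputable def wittIndex (Q : QuadraticForm F V) : ℕ :=
  sSup {k | ∃ N : Submodule F V, IsTotallySingular Q N ∧ Module.finrank F N = k}

/-- Elliptic type: nondegenerate, of even dimension `2m`, with Witt index `m - 1`. -/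
def IsElliptic (Q : QuadraticForm F V) : Prop :=
  IsNondegenerate Q ∧ Module.finrank F V = 2 * (wittIndex Q + 1)

/-- The restriction of a quadratic form to a subspace. -/
def restrictForm (Q : QuadraticForm F V) (W : Submodule F V) : QuadraticForm F W :=
  Q.comp W.subtype

/-- The perp of a subspace with respect to the associated bilinear form. -/
def perp (Q : QuadraticForm F V) (W : Submodule F V) : Submodule F V where
  carrier := {v | ∀ w ∈ W, QuadraticMap.polar Q w v = 0}
  zero_mem' := by intro w _; simp
  add_mem' := by
    intro a b ha hb w hw
    rw [QuadraticMap.polar_add_right, ha w hw, hb w hw, add_zero]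
  smul_mem' := by
    intro c a ha w hw
    rw [QuadraticMap.polar_smul_right, ha w hw, smul_zero]

/-- The points of the quadric: totally singular subspaces of dimension one. -/
def QPoint (Q : QuadraticForm F V) : Type _ :=
  {N : Submodule F V // IsTotallySingular Q N ∧ Module.finrank F N = 1}

/-- The maximals of the quadric: totally singular subspaces of the largest dimension. -/
def QMaximal (Q : QuadraticForm F V) : Type _ :=
  {N : Submodule F V // IsTotallySingular Q N ∧ Module.finrank F N = wittIndex Q}

/-- Incidence of points and maximals is inclusion. -/
def qIncident (Q : QuadraticForm F V) (p : QPoint Q) (m : QMaximal Q) : Prop :=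
  p.1 ≤ m.1

/-! ### Orthogonal groups and their action on the quadric -/

/-- The orthogonal group `O(V)`. -/
def orthGroup (Q : QuadraticForm F V) : Subgroup (V ≃ₗ[F] V) where
  carrier := {g | ∀ v, Q (g v) = Q v}
  one_mem' := by intro v; rfl
  mul_mem' := by
    intro a b ha hb v
    exact (ha _).trans (hb _)
  inv_mem' := by
    intro a ha v
    have h := ha (a⁻¹ v)
    have h2 : a (a⁻¹ v) = v := a.apply_symm_apply v
    rw [h2] at h
    exact h.symm

/-- `Ω(V)`, the derived subgroup of `O(V)`. -/
def omegaGroup (Q : QuadraticForm F V) : Subgroup (orthGroup Q) :=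
  commutator (orthGroup Q)

theorem orthGroup_map_singular (Q : QuadraticForm F V) (g : orthGroup Q) {N : Submodule F V}
    (hN : IsTotallySingular Q N) : IsTotallySingular Q (N.map (g.1 : V →ₗ[F] V)) := by
  rintro _ ⟨v, hv, rfl⟩
  exact (g.2 v).trans (hN v hv)

theorem orthGroup_map_one (Q : QuadraticForm F V) (N : Submodule F V) :
    N.map (((1 : orthGroup Q).1 : V ≃ₗ[F] V) : V →ₗ[F] V) = N :=
  Submodule.map_id N

theorem orthGroup_map_mul (Q : QuadraticForm F V) (a b : orthGroup Q) (N : Submodule F V) :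
    N.map (((a * b).1 : V ≃ₗ[F] V) : V →ₗ[F] V) =
      (N.map (b.1 : V →ₗ[F] V)).map (a.1 : V →ₗ[F] V) :=
  Submodule.map_comp (b.1 : V →ₗ[F] V) (a.1 : V →ₗ[F] V) N

instance qPointAction (Q : QuadraticForm F V) : MulAction (orthGroup Q) (QPoint Q) where
  smul g p := ⟨p.1.map (g.1 : V →ₗ[F] V), orthGroup_map_singular Q g p.2.1,
    (LinearEquiv.finrank_map_eq g.1 p.1).trans p.2.2⟩
  one_smul p := Subtype.ext (orthGroup_map_one Q p.1)
  mul_smul a b p := Subtype.ext (orthGroup_map_mul Q a b p.1)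

instance qMaximalAction (Q : QuadraticForm F V) : MulAction (orthGroup Q) (QMaximal Q) where
  smul g m := ⟨m.1.map (g.1 : V →ₗ[F] V), orthGroup_map_singular Q g m.2.1,
    (LinearEquiv.finrank_map_eq g.1 m.1).trans m.2.2⟩
  one_smul m := Subtype.ext (orthGroup_map_one Q m.1)
  mul_smul a b m := Subtype.ext (orthGroup_map_mul Q a b m.1)

/-- `Ω(W) = {g ⊕ 1 on the perp of W : g ∈ Ω of the form restricted to W}`, inside `O(V)`. -/
def omegaOn (Q : QuadraticForm F V) (W : Submodule F V) : Subgroup (orthGroup Q) where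
  carrier := {h | ∃ g ∈ omegaGroup (restrictForm Q W),
    (∀ w : W, h.1 (w : V) = ((g.1 w : W) : V)) ∧ ∀ u ∈ perp Q W, h.1 u = u}
  one_mem' := ⟨1, one_mem _, fun _ => rfl, fun _ _ => rfl⟩
  mul_mem' := by
    rintro a b ⟨g, hg, hgw, hgu⟩ ⟨k, hk, hkw, hku⟩
    refine ⟨g * k, mul_mem hg hk, fun w => ?_, fun u hu => ?_⟩
    · change a.1 (b.1 (w : V)) = ((g.1 (k.1 w) : W) : V)
      rw [hkw, hgw]
    · change a.1 (b.1 u) = u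
      rw [hku u hu, hgu u hu]
  inv_mem' := by
    rintro a ⟨g, hg, hgw, hgu⟩
    refine ⟨g⁻¹, inv_mem hg, fun w => ?_, fun u hu => ?_⟩
    · change a.1.symm (w : V) = ((g.1.symm w : W) : V)
      rw [LinearEquiv.symm_apply_eq, hgw, LinearEquiv.apply_symm_apply]
    · change a.1.symm u = u
      rw [LinearEquiv.symm_apply_eq, hgu u hu]

/-- The reflection `v ↦ v - (β(z, v) / Q z) z`: it negates `z` and fixes the perp of `z`. -/
noncomputable def reflectionIn (Q : QuadraticForm F V) (z : V) (hz : Q z ≠ 0) : orthGroup Q :=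
  ⟨Module.reflection (x := z) (f := (Q z)⁻¹ • Q.polarBilin z) (by
      rw [LinearMap.smul_apply, QuadraticMap.polarBilin_apply_apply, QuadraticMap.polar_self,
        smul_eq_mul, two_nsmul]
      field_simp
      norm_num), by
    intro v
    rw [Module.reflection_apply, sub_eq_add_neg, ← neg_smul, QuadraticMap.map_add Q,
      QuadraticMap.map_smul, QuadraticMap.polar_smul_right, QuadraticMap.polar_comm Q v z,
      LinearMap.smul_apply, QuadraticMap.polarBilin_apply_apply]
    simp only [smul_eq_mul]
    field_simp
    ring⟩

/-- `W = ⟨z, e, f⟩`. -/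
def frameSpace (F : Type*) {V : Type*} [Field F] [AddCommGroup V] [Module F V] (z e f : V) :
    Submodule F V :=
  Submodule.span F {z, e, f}

/-- `z` is nonsingular, `(e, f)` is a hyperbolic pair orthogonal to `z`, and the perp of the
subspace `⟨z, e, f⟩` is of elliptic type. -/
structure IsFrame (Q : QuadraticForm F V) (z e f : V) : Prop where
  nonsingular : Q z ≠ 0
  e_singular : Q e = 0
  f_singular : Q f = 0
  hyperbolic : QuadraticMap.polar Q e f = 1
  orth_e : QuadraticMap.polar Q z e = 0
  orth_f : QuadraticMap.polar Q z f = 0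
  elliptic : IsElliptic (restrictForm Q (perp Q (frameSpace F z e f)))

/-- `B = Ω(W)` for `W = ⟨z, e, f⟩`. -/
def groupB (Q : QuadraticForm F V) (z e f : V) : Subgroup (orthGroup Q) :=
  omegaOn Q (frameSpace F z e f)

/-- `A = ⟨B, τ⟩`, with `τ` the reflection in `z`. -/
noncomputable def groupA (Q : QuadraticForm F V) (z e f : V) (hz : Q z ≠ 0) :
    Subgroup (orthGroup Q) :=
  Subgroup.closure (insert (reflectionIn Q z hz) (groupB Q z e f : Set (orthGroup Q)))

end Quadric

/-! Everything rests on two facts about τ. For every vector v some b ∈ B satisfies bv = τv, so τ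
keeps each point inside its B-orbit. No element of τB fixes a maximal, so τ moves each maximal out
of its B-orbit. Since τ is an involution normalising B, A = B ∪ Bτ, and each A-orbit on maximals
consists of two B-orbits interchanged by τ. Choosing one of the two in every A-orbit gives 2^n sets
H that τ maps to their complements. For a point p with bp = τp, the element b⁻¹τ fixes p and
exchanges H with its complement, so H contains half of the maximals on p
(`IsFrame.isHemisystem_of_mem_halves`).

Both facts are computed in the traceless 2 × 2 matrices under the determinant, to which W is
similar, with z becoming Z = diag(1, -1). There orthogonal means anticommuting, the isometries are
conjugations up to sign, Ω(W) is conjugation by SL₂ (hence PSL₂), and τΩ(W) consists of the maps w ↦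
-hwh⁻¹ with det h = -1.

Points: given w, choose x orthogonal to w with det x = -1. Conjugation by Zx has determinant one and
agrees with τ at w (`Traceless.exists_omegaGroup_apply_eq`).

Maximals: suppose an element of τB fixes a maximal M. Let P be the projection of M to W and L = M ∩
W. The element acts trivially on P modulo L, and L is orthogonal to P. As U has Witt index d - 2,
dim P ≥ 2, and P is anisotropic if L = 0 and dim P = 2. If L = 0, then h anticommutes with P, so h
is traceless and P is the plane orthogonal to h; that plane has singular vectors because det h = -1.
If L contains w ≠ 0, then w is nilpotent, wh = αw and wx = βw for some x in P with α, β ≠ 0, and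
2αβw = 0. Either way there is a contradiction (`Traceless.false_of_reflectionIn_mul_sub_mem`,
`IsFrame.reflectionIn_mul_smul_ne`).

What remains is the existence of an elliptic hyperplane, built from a nonsquare; the constancy of
the order, from transitivity on points; and the faithfulness of B on points, which holds because U ≠
0. -/

/-! ### Traceless `2 × 2` matrices -/

section Traceless

open Matrix
open scoped MatrixGroups commutatorElement

/-- The space of traceless `2 × 2` matrices. -/
abbrev Traceless (F : Type*) [Field F] : Submodule F (Matrix (Fin 2) (Fin 2) F) :=
  LinearMap.ker (Matrix.traceLinearMap (Fin 2) F F)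

variable {F : Type*} [Field F]

theorem mem_traceless_iff {M : Matrix (Fin 2) (Fin 2) F} : M ∈ Traceless F ↔ M.trace = 0 := by
  simp [Traceless]

namespace Traceless

theorem apply_one_one (M : Traceless F) : M.1 1 1 = -M.1 0 0 := by
  have h := mem_traceless_iff.1 M.2
  rw [Matrix.trace_fin_two] at h
  linear_combination h

/-- The traceless matrix with first row `(a, b)` and lower left entry `c`. -/
def mk (a b c : F) : Traceless F :=
  ⟨!![a, b; c, -a], by simp [Matrix.trace_fin_two]⟩

theorem coe_mk (a b c : F) : (mk a b c : Matrix (Fin 2) (Fin 2) F) = !![a, b; c, -a] := rfl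

theorem eq_mk (M : Traceless F) : M = mk (M.1 0 0) (M.1 0 1) (M.1 1 0) := by
  apply Subtype.ext
  ext i j
  fin_cases i <;> fin_cases j <;> simp [mk, apply_one_one]

theorem exists_eq_mk (M : Traceless F) : ∃ a b c, M = mk a b c := ⟨_, _, _, eq_mk M⟩

theorem mk_eq_zero {a b c : F} : mk a b c = 0 ↔ a = 0 ∧ b = 0 ∧ c = 0 := by
  constructor
  · intro h
    have h' := congrArg Subtype.val h
    refine ⟨?_, ?_, ?_⟩
    · simpa [mk] using congrFun (congrFun h' 0) 0
    · simpa [mk] using congrFun (congrFun h' 0) 1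
    · simpa [mk] using congrFun (congrFun h' 1) 0
  · rintro ⟨rfl, rfl, rfl⟩
    apply Subtype.ext
    ext i j
    fin_cases i <;> fin_cases j <;> simp [mk]

/-- The `(i, j)` entry as a linear functional. -/
def entry (F : Type*) [Field F] (i j : Fin 2) : Traceless F →ₗ[F] F :=
  (Matrix.entryLinearMap F F i j).comp (Traceless F).subtype

/-- The determinant as a quadratic form on the traceless matrices. -/
def detForm (F : Type*) [Field F] : QuadraticForm F (Traceless F) :=
  QuadraticMap.linMulLin (entry F 0 0) (entry F 1 1) -
    QuadraticMap.linMulLin (entry F 0 1) (entry F 1 0)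

theorem detForm_apply (M : Traceless F) : detForm F M = M.1.det := by
  simp [detForm, entry, Matrix.det_fin_two]

theorem detForm_mk (a b c : F) : detForm F (mk a b c) = -(a ^ 2 + b * c) := by
  rw [detForm_apply, coe_mk, Matrix.det_fin_two_of]
  ring

theorem polar_mk (a b c a' b' c' : F) :
    QuadraticMap.polar (detForm F) (mk a b c) (mk a' b' c') =
      -(2 * a * a' + b * c' + c * b') := by
  have : mk a b c + mk a' b' c' = mk (a + a') (b + b') (c + c') := by
    apply Subtype.ext
    ext i j
    fin_cases i <;> fin_cases j <;> simp [mk]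
    ring
  rw [QuadraticMap.polar, this, detForm_mk, detForm_mk, detForm_mk]
  ring

/-! ### Conjugation as a group of isometries. -/

/-- `M ↦ h M h⁻¹` on traceless matrices. -/
def conjLinear (h : GL (Fin 2) F) : Traceless F →ₗ[F] Traceless F where
  toFun M := ⟨h.1 * M.1 * h⁻¹.1, by
    rw [mem_traceless_iff, Matrix.trace_mul_comm, ← mul_assoc]
    have : (h⁻¹.1 : Matrix (Fin 2) (Fin 2) F) * h.1 = 1 := h.inv_mul
    rw [this, one_mul]
    exact mem_traceless_iff.1 M.2⟩
  map_add' M N := by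
    apply Subtype.ext
    simp [mul_add, add_mul]
  map_smul' c M := by
    apply Subtype.ext
    simp

theorem coe_conjLinear (h : GL (Fin 2) F) (M : Traceless F) :
    (conjLinear h M : Matrix (Fin 2) (Fin 2) F) = h.1 * M.1 * h⁻¹.1 := rfl

theorem conjLinear_mul (h k : GL (Fin 2) F) (M : Traceless F) :
    conjLinear (h * k) M = conjLinear h (conjLinear k M) := by
  apply Subtype.ext
  simp only [coe_conjLinear, _root_.mul_inv_rev, Units.val_mul, mul_assoc]

theorem conjLinear_one (M : Traceless F) : conjLinear 1 M = M := by
  apply Subtype.ext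
  simp [coe_conjLinear]

/-- The conjugation action of `GL₂` on traceless matrices, by isometries of the determinant. -/
def conjOrth (F : Type*) [Field F] : GL (Fin 2) F →* orthGroup (detForm F) where
  toFun h := ⟨LinearEquiv.ofLinearMap (conjLinear h) (conjLinear h⁻¹)
      (by
        ext1 M
        rw [LinearMap.comp_apply, ← conjLinear_mul, mul_inv_cancel, conjLinear_one]
        rfl)
      (by
        ext1 M
        rw [LinearMap.comp_apply, ← conjLinear_mul, inv_mul_cancel, conjLinear_one]
        rfl), by
    intro M
    change detForm F (conjLinear h M) = _
    rw [detForm_apply, detForm_apply, coe_conjLinear, Matrix.det_mul, Matrix.det_mul,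
      mul_right_comm, ← Matrix.det_mul]
    have : (h.1 : Matrix (Fin 2) (Fin 2) F) * h⁻¹.1 = 1 := h.mul_inv
    rw [this, Matrix.det_one, one_mul]⟩
  map_one' := by
    apply Subtype.ext
    ext1 M
    exact conjLinear_one M
  map_mul' h k := by
    apply Subtype.ext
    ext1 M
    exact conjLinear_mul h k M

theorem coe_conjOrth_apply (h : GL (Fin 2) F) (M : Traceless F) :
    (((conjOrth F h).1 M : Traceless F) : Matrix (Fin 2) (Fin 2) F) = h.1 * M.1 * h⁻¹.1 := rfl

theorem conjOrth_apply_eq_iff {h : GL (Fin 2) F} {M N : Traceless F} :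
    (conjOrth F h).1 M = N ↔ h.1 * M.1 = N.1 * h.1 := by
  rw [← Subtype.coe_inj, coe_conjOrth_apply]
  have h1 : (h.1 : Matrix (Fin 2) (Fin 2) F) * h⁻¹.1 = 1 := h.mul_inv
  have h2 : (h⁻¹.1 : Matrix (Fin 2) (Fin 2) F) * h.1 = 1 := h.inv_mul
  constructor
  · intro e
    rw [← e, mul_assoc, h2, mul_one]
  · intro e
    rw [e, mul_assoc, h1, mul_one]

theorem conjOrth_eq_iff {h : GL (Fin 2) F} {g : orthGroup (detForm F)} :
    conjOrth F h = g ↔ ∀ M : Traceless F, h.1 * M.1 = (g.1 M).1 * h.1 := by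
  constructor
  · rintro rfl M
    exact conjOrth_apply_eq_iff.1 rfl
  · intro e
    apply Subtype.ext
    ext1 M
    exact conjOrth_apply_eq_iff.2 (e M)

/-! ### Isometries of the determinant form are conjugations up to sign. -/

/-- The isometry `-1`. -/
def negOrth (F : Type*) [Field F] : orthGroup (detForm F) :=
  ⟨LinearEquiv.neg F, fun v => by
    rw [LinearEquiv.neg_apply, QuadraticMap.map_neg]⟩

theorem negOrth_mem_center : negOrth F ∈ Subgroup.center (orthGroup (detForm F)) := by
  rw [Subgroup.mem_center_iff]
  intro g
  apply Subtype.ext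
  ext1 M
  exact map_neg g.1 M

theorem negOrth_mul_self : negOrth F * negOrth F = 1 := by
  apply Subtype.ext
  ext1 M
  exact neg_neg M

theorem mk_eq_add (a b c : F) : mk a b c = a • mk 1 0 0 + b • mk 0 1 0 + c • mk 0 0 1 := by
  apply Subtype.ext
  ext i j
  fin_cases i <;> fin_cases j <;> simp [mk]

/-- An invertible matrix from one with nonzero determinant. -/
noncomputable abbrev toGL (M : Matrix (Fin 2) (Fin 2) F) (hM : M.det ≠ 0) : GL (Fin 2) F :=
  Matrix.GeneralLinearGroup.mkOfDetNeZero M hM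

theorem coe_toGL (M : Matrix (Fin 2) (Fin 2) F) (hM : M.det ≠ 0) : (toGL M hM).1 = M := rfl

/-- An isometry fixing diag(1, -1) preserves the orthogonal hyperbolic plane, whose only singular
lines are spanned by the two off-diagonal matrix units. It either fixes both lines, and is
conjugation by a diagonal matrix, or swaps them. In the second case an antidiagonal matrix does the
same on the plane but negates diag(1, -1), whence the factor `negOrth` and the entry `-c`. -/
theorem exists_conjOrth_of_fixed {g : orthGroup (detForm F)} (h2 : (2 : F) ≠ 0)
    (hg : g.1 (mk 1 0 0) = mk 1 0 0) :
    (∃ h, g = conjOrth F h) ∨ ∃ h, g = negOrth F * conjOrth F h := by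
  have hp : ∀ M N, QuadraticMap.polar (detForm F) (g.1 M) (g.1 N) =
      QuadraticMap.polar (detForm F) M N := by
    intro M N
    rw [QuadraticMap.polar, QuadraticMap.polar, ← map_add, g.2, g.2, g.2]
  obtain ⟨a, b, c, he⟩ := exists_eq_mk (g.1 (mk 0 1 0))
  obtain ⟨a', b', c', hf⟩ := exists_eq_mk (g.1 (mk 0 0 1))
  have h1 := hp (mk 1 0 0) (mk 0 1 0)
  have h3 := hp (mk 1 0 0) (mk 0 0 1)
  have h4 := hp (mk 0 1 0) (mk 0 0 1)
  have h5 := g.2 (mk 0 1 0)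
  have h6 := g.2 (mk 0 0 1)
  rw [hg, he, polar_mk, polar_mk] at h1
  rw [hg, hf, polar_mk, polar_mk] at h3
  rw [he, hf, polar_mk, polar_mk] at h4
  rw [he, detForm_mk, detForm_mk] at h5
  rw [hf, detForm_mk, detForm_mk] at h6
  have ha : a = 0 := by
    have : 2 * a = 0 := by linear_combination -h1
    simpa [h2] using this
  have ha' : a' = 0 := by
    have : 2 * a' = 0 := by linear_combination -h3
    simpa [h2] using this
  subst ha ha'
  have hbc : b * c = 0 := by linear_combination -h5
  have hbc' : b' * c' = 0 := by linear_combination -h6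
  have h1' : b * c' + c * b' = 1 := by linear_combination -h4
  have key : ∀ p q r : F, g.1 (mk p q r) = mk p (q * b + r * b') (q * c + r * c') := by
    intro p q r
    rw [mk_eq_add, map_add, map_add, map_smul, map_smul, map_smul, hg, he, hf]
    apply Subtype.ext
    ext i j
    fin_cases i <;> fin_cases j <;> simp [mk]
  rcases mul_eq_zero.1 hbc with rfl | rfl
  · have hc : c ≠ 0 := by rintro rfl; simp at h1'
    have hb' : b' ≠ 0 := by rintro rfl; simp at h1'
    have hc' : c' = 0 := by simpa [hb'] using hbc'
    subst hc'
    right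
    have hd : (!![0, 1; -c, 0] : Matrix (Fin 2) (Fin 2) F).det ≠ 0 := by
      rw [Matrix.det_fin_two_of]; simpa using hc
    refine ⟨toGL _ hd, ?_⟩
    rw [← inv_mul_eq_iff_eq_mul, inv_eq_of_mul_eq_one_left (negOrth_mul_self (F := F)), eq_comm,
      conjOrth_eq_iff]
    intro M
    obtain ⟨p, q, r, rfl⟩ := exists_eq_mk M
    change _ = ((-(g.1 (mk p q r)) : Traceless F) : Matrix (Fin 2) (Fin 2) F) * _
    rw [key, coe_toGL]
    have h7 : c * b' = 1 := by linear_combination h1'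
    ext i j
    fin_cases i <;> fin_cases j <;> simp [mk, Matrix.mul_apply, Fin.sum_univ_two]
    · linear_combination -r * h7
    · ring
    · ring
  · have hc : b ≠ 0 := by rintro rfl; simp at h1'
    have hb' : c' ≠ 0 := by rintro rfl; simp at h1'
    have hc' : b' = 0 := by simpa [hb'] using hbc'
    subst hc'
    left
    have hd : (!![b, 0; 0, 1] : Matrix (Fin 2) (Fin 2) F).det ≠ 0 := by
      rw [Matrix.det_fin_two_of]; simpa using hc
    refine ⟨toGL _ hd, ?_⟩
    rw [eq_comm, conjOrth_eq_iff]
    intro M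
    obtain ⟨p, q, r, rfl⟩ := exists_eq_mk M
    rw [key, coe_toGL]
    have h7 : b * c' = 1 := by linear_combination h1'
    ext i j
    fin_cases i <;> fin_cases j <;> simp [mk, Matrix.mul_apply, Fin.sum_univ_two]
    · ring
    · ring
    · linear_combination -r * h7

/-- Cayley–Hamilton at trace zero. -/
theorem sq_eq_neg_det (M : Traceless F) :
    M.1 * M.1 = -M.1.det • (1 : Matrix (Fin 2) (Fin 2) F) := by
  obtain ⟨a, b, c, rfl⟩ := exists_eq_mk M
  ext i j
  fin_cases i <;> fin_cases j <;>
    simp [mk, Matrix.mul_apply, Fin.sum_univ_two, Matrix.det_fin_two] <;> ring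

/-- Every isometry of the determinant form is a conjugation up to a central factor. -/
theorem exists_center_mul_conjOrth (h2 : (2 : F) ≠ 0) (g : orthGroup (detForm F)) :
    ∃ n ∈ Subgroup.center (orthGroup (detForm F)), ∃ h, g = n * conjOrth F h := by
  have hfix : ∀ k : orthGroup (detForm F), k.1 (mk 1 0 0) = mk 1 0 0 →
      ∃ n ∈ Subgroup.center (orthGroup (detForm F)), ∃ h, k = n * conjOrth F h := by
    intro k hk
    rcases exists_conjOrth_of_fixed h2 hk with ⟨h, rfl⟩ | ⟨h, rfl⟩
    · exact ⟨1, one_mem _, h, (one_mul _).symm⟩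
    · exact ⟨_, negOrth_mem_center, h, rfl⟩
  set x := g.1 (mk 1 0 0) with hx
  have hdz : (mk (1 : F) 0 0).1.det = -1 := by simp [mk, Matrix.det_fin_two]
  have hdx : x.1.det = -1 := by
    rw [← detForm_apply, hx, g.2, detForm_apply, hdz]
  have hxx := sq_eq_neg_det x
  have hzz := sq_eq_neg_det (mk (1 : F) 0 0)
  rw [hdx] at hxx
  rw [hdz] at hzz
  -- Put Z = diag(1, -1). Since x² = Z² = 1, (x + Z)x = Z(x + Z) and (x - Z)x = -Z(x - Z), so
  -- conjugation by x + Z or x - Z carries x to Z or -Z. The parallelogram law gives determinants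
  -- summing to -4, so one of the two matrices is invertible.
  have hsum : (x.1 - (mk (1 : F) 0 0).1).det + (x.1 + (mk (1 : F) 0 0).1).det = -4 := by
    have e : (x.1 - (mk (1 : F) 0 0).1).det + (x.1 + (mk (1 : F) 0 0).1).det =
        2 * x.1.det + 2 * (mk (1 : F) 0 0).1.det := by
      simp [Matrix.det_fin_two]
      ring
    rw [e, hdx, hdz]
    norm_num
  by_cases hd : (x.1 + (mk (1 : F) 0 0).1).det = 0
  · have hd' : (x.1 - (mk (1 : F) 0 0).1).det ≠ 0 := by
      intro h0
      rw [h0, hd] at hsum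
      apply mul_ne_zero h2 h2
      linear_combination hsum
    obtain ⟨n, hn, h, e⟩ := hfix (negOrth F * conjOrth F (toGL _ hd') * g) (by
      change -((conjOrth F (toGL _ hd')).1 x) = _
      rw [neg_eq_iff_eq_neg, conjOrth_apply_eq_iff, coe_toGL]
      rw [Submodule.coe_neg, sub_mul, neg_mul, mul_sub, hxx, hzz, neg_sub])
    refine ⟨(negOrth F)⁻¹ * n, mul_mem (inv_mem negOrth_mem_center) hn, (toGL _ hd')⁻¹ * h, ?_⟩
    have hn' := Subgroup.mem_center_iff.1 hn
    have hc := Subgroup.mem_center_iff.1 (negOrth_mem_center (F := F))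
    rw [map_mul, map_inv, mul_assoc, ← mul_assoc n, ← hn', mul_assoc, ← e, ← hc]
    group
  · obtain ⟨n, hn, h, e⟩ := hfix (conjOrth F (toGL _ hd) * g) (by
      change (conjOrth F (toGL _ hd)).1 x = _
      rw [conjOrth_apply_eq_iff, coe_toGL]
      rw [add_mul, mul_add, hxx, hzz, add_comm])
    refine ⟨n, hn, (toGL _ hd)⁻¹ * h, ?_⟩
    have hn' := Subgroup.mem_center_iff.1 hn
    rw [map_mul, map_inv, ← mul_assoc n, ← hn', mul_assoc, ← e]
    group

/-! ### The derived group is the image of SL₂. -/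

theorem commutatorElement_center_mul {G : Type*} [Group G] {m n : G}
    (hm : m ∈ Subgroup.center G) (hn : n ∈ Subgroup.center G) (a b : G) :
    ⁅m * a, n * b⁆ = ⁅a, b⁆ := by
  have hm' := Subgroup.mem_center_iff.1 hm
  have hn' := Subgroup.mem_center_iff.1 hn
  have hmn : ∀ g : G, g * (m * n) = m * n * g := fun g => by
    rw [← mul_assoc, hm', mul_assoc, hn', mul_assoc]
  have e : m * a * (n * b) = m * n * (a * b) := by
    rw [mul_assoc m a, ← mul_assoc a n b, hn' a]
    simp only [mul_assoc]
  have e' : n * b * (m * a) = m * n * (b * a) := by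
    rw [mul_assoc n b, ← mul_assoc b m a, hm' b, ← hm' n]
    simp only [mul_assoc]
  rw [commutatorElement_def, commutatorElement_def, mul_assoc, ← _root_.mul_inv_rev, e, e',
    ← hmn, ← hmn]
  group

/-- Conjugation by matrices of determinant one. -/
def conjSL (F : Type*) [Field F] : SL(2, F) →* orthGroup (detForm F) :=
  (conjOrth F).comp Matrix.SpecialLinearGroup.toGL

theorem conjOrth_commutator_mem_range (h k : GL (Fin 2) F) :
    conjOrth F ⁅h, k⁆ ∈ (conjSL F).range := by
  have hdet : (⁅h, k⁆ : GL (Fin 2) F).1.det = 1 := by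
    have : Matrix.GeneralLinearGroup.det ⁅h, k⁆ = 1 := by
      rw [map_commutatorElement, commutatorElement_eq_one_iff_mul_comm, mul_comm]
    exact congrArg Units.val this
  refine ⟨⟨_, hdet⟩, ?_⟩
  change conjOrth F _ = _
  congr 1
  ext i j
  rfl

/-- A diagonal reflection D of determinant -1 inverts the transvection E(t), so [D, E(t)] = E(-2t),
and t = -c/2 gives E(c). Taking D outside SL₂ makes this valid also over the field of order three,
where SL₂ is not perfect. -/
theorem conjSL_transvection_mem_commutator (h2 : (2 : F) ≠ 0) {i j : Fin 2} (hij : i ≠ j) (c : F) :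
    conjSL F (Matrix.SpecialLinearGroup.transvection hij c) ∈ omegaGroup (detForm F) := by
  have hd : (Matrix.diagonal (fun l => if l = i then (-1 : F) else 1)).det ≠ 0 := by
    rw [Matrix.det_diagonal, Fin.prod_univ_two]
    split_ifs <;> simp
  have e : Matrix.SpecialLinearGroup.toGL (Matrix.SpecialLinearGroup.transvection hij c) =
      ⁅toGL _ hd, Matrix.SpecialLinearGroup.toGL
        (Matrix.SpecialLinearGroup.transvection hij (-c / 2))⁆ := by
    rw [commutatorElement_def, eq_mul_inv_iff_mul_eq, eq_mul_inv_iff_mul_eq]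
    apply Units.ext
    simp only [Units.val_mul, coe_toGL, Matrix.SpecialLinearGroup.coe_GL_coe_matrix,
      Matrix.SpecialLinearGroup.transvection_coe]
    ext a b
    fin_cases i <;> fin_cases j <;> first | exact absurd rfl hij | skip
    all_goals
      fin_cases a <;> fin_cases b <;> simp [Matrix.mul_apply, Fin.sum_univ_two]
    all_goals
      field_simp
      ring
  change conjOrth F _ ∈ _
  rw [e, map_commutatorElement]
  exact Subgroup.commutator_mem_commutator (Subgroup.mem_top _) (Subgroup.mem_top _)

/-- The derived group of the orthogonal group of the determinant form is the image of `SL₂`. -/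
theorem omegaGroup_detForm (h2 : (2 : F) ≠ 0) : omegaGroup (detForm F) = (conjSL F).range := by
  apply le_antisymm
  · rw [omegaGroup, commutator_def, Subgroup.commutator_le]
    intro g _ k _
    obtain ⟨m, hm, h, rfl⟩ := exists_center_mul_conjOrth h2 g
    obtain ⟨n, hn, h', rfl⟩ := exists_center_mul_conjOrth h2 k
    rw [commutatorElement_center_mul hm hn, ← map_commutatorElement]
    exact conjOrth_commutator_mem_range _ _
  · rintro _ ⟨s, rfl⟩
    induction s using Matrix.SL2.transvection_induction with
    | htransvec i j hij c => exact conjSL_transvection_mem_commutator h2 hij c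
    | hmul A B hA hB => rw [map_mul]; exact mul_mem hA hB

theorem ker_conjSL : (conjSL F).ker = Subgroup.center SL(2, F) := by
  ext s
  rw [MonoidHom.mem_ker, Matrix.SpecialLinearGroup.mem_center_iff]
  change conjOrth F _ = 1 ↔ _
  rw [conjOrth_eq_iff]
  constructor
  · intro h
    have h1 := h (mk 0 1 0)
    have h3 := h (mk 0 0 1)
    change s.1 * _ = _ * s.1 at h1
    change s.1 * _ = _ * s.1 at h3
    have h10 : s.1 1 0 = 0 := by
      simpa [mk, Matrix.mul_apply, Fin.sum_univ_two] using congrFun (congrFun h1 1) 1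
    have h01 : s.1 0 1 = 0 := by
      simpa [mk, Matrix.mul_apply, Fin.sum_univ_two] using congrFun (congrFun h3 0) 0
    have h11 : s.1 0 0 = s.1 1 1 := by
      simpa [mk, Matrix.mul_apply, Fin.sum_univ_two] using congrFun (congrFun h1 0) 1
    have hdet := s.2
    rw [Matrix.det_fin_two, h10, h01, ← h11] at hdet
    refine ⟨s.1 0 0, ?_, ?_⟩
    · simp only [Fintype.card_fin]
      linear_combination hdet
    · ext i j
      fin_cases i <;> fin_cases j <;> simp [h10, h01, h11]
  · rintro ⟨r, -, hr⟩ M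
    change s.1 * _ = _ * s.1
    rw [← hr]
    exact (Matrix.scalar_commute r (fun r' => mul_comm r r') M.1).eq

/-- The derived group of the orthogonal group of the determinant form is `PSL₂`. -/
theorem nonempty_omegaGroup_detForm_mulEquiv (h2 : (2 : F) ≠ 0) :
    Nonempty (omegaGroup (detForm F) ≃* Matrix.ProjectiveSpecialLinearGroup (Fin 2) F) :=
  ⟨(MulEquiv.subgroupCongr (omegaGroup_detForm h2)).trans
    ((QuotientGroup.quotientKerEquivRange (conjSL F)).symm.trans
      (QuotientGroup.quotientMulEquivOfEq ker_conjSL))⟩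

/-- Polarisation of `sq_eq_neg_det`. It makes orthogonality of traceless matrices the same as
anticommutation. -/
theorem polar_detForm (M N : Traceless F) :
    M.1 * N.1 + N.1 * M.1 =
      -QuadraticMap.polar (detForm F) M N • (1 : Matrix (Fin 2) (Fin 2) F) := by
  obtain ⟨a, b, c, rfl⟩ := exists_eq_mk M
  obtain ⟨a', b', c', rfl⟩ := exists_eq_mk N
  rw [polar_mk]
  ext i j
  fin_cases i <;> fin_cases j <;>
    simp [mk] <;> ring

/-- A triangular matrix with diagonal (1, -1) has determinant -1 whatever its off-diagonal entry,
which can be tuned to orthogonality as soon as w has a nonzero off-diagonal entry. A diagonal w is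
orthogonal to the antidiagonal matrix of ones. -/
theorem exists_orthogonal_det_neg_one (w : Traceless F) :
    ∃ x : Traceless F, x.1.det = -1 ∧ QuadraticMap.polar (detForm F) x w = 0 := by
  obtain ⟨a, b, c, rfl⟩ := exists_eq_mk w
  by_cases hb : b = 0
  · by_cases hc : c = 0
    · refine ⟨mk 0 1 1, ?_, ?_⟩
      · rw [← detForm_apply, detForm_mk]; ring
      · rw [polar_mk, hb, hc]; ring
    · refine ⟨mk 1 (-(2 * a) / c) 0, ?_, ?_⟩
      · rw [← detForm_apply, detForm_mk]; ring
      · rw [polar_mk, hb]; field_simp; ring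
  · refine ⟨mk 1 0 (-(2 * a) / b), ?_, ?_⟩
    · rw [← detForm_apply, detForm_mk]; ring
    · rw [polar_mk]; field_simp; ring

/-! ### The reflection in diag(1, -1) and its coset of the derived group. -/

theorem detForm_mk_one_ne_zero : detForm F (mk 1 0 0) ≠ 0 := by
  rw [detForm_mk]; simp

theorem reflectionIn_mk (a b c : F) :
    (reflectionIn (detForm F) (mk 1 0 0) detForm_mk_one_ne_zero).1 (mk a b c) = mk (-a) b c := by
  rw [reflectionIn, Module.reflection_apply, LinearMap.smul_apply,
    QuadraticMap.polarBilin_apply_apply, polar_mk, detForm_mk]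
  apply Subtype.ext
  ext i j
  fin_cases i <;> fin_cases j <;> simp [mk] <;> ring

/-- The reflection is minus conjugation by diag(1, -1), since that conjugation is a half-turn about
the same axis. -/
theorem mul_reflectionIn (w : Traceless F) :
    (mk 1 0 0).1 * w.1 =
      -(((reflectionIn (detForm F) (mk 1 0 0) detForm_mk_one_ne_zero).1 w).1 * (mk 1 0 0).1) := by
  obtain ⟨a, b, c, rfl⟩ := exists_eq_mk w
  rw [reflectionIn_mk]
  ext i j
  fin_cases i <;> fin_cases j <;> simp [mk]

/-- The reflection in `mk 1 0 0` agrees at each vector with some element of the derived group. -/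
theorem exists_omegaGroup_apply_eq (h2 : (2 : F) ≠ 0) (w : Traceless F) :
    ∃ s ∈ omegaGroup (detForm F),
      s.1 w = (reflectionIn (detForm F) (mk 1 0 0) detForm_mk_one_ne_zero).1 w := by
  -- As x anticommutes with w, conjugation by x negates w. Following it with conjugation by Z =
  -- diag(1, -1) gives -ZwZ⁻¹, the reflected vector, while det(Zx) = 1.
  obtain ⟨x, hx, hxw⟩ := exists_orthogonal_det_neg_one w
  have hd : ((mk (1 : F) 0 0).1 * x.1).det = 1 := by
    rw [Matrix.det_mul, hx, ← detForm_apply, detForm_mk]; ring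
  refine ⟨conjSL F ⟨_, hd⟩, ?_, ?_⟩
  · rw [omegaGroup_detForm h2]; exact ⟨_, rfl⟩
  · change (conjOrth F _).1 w = _
    rw [conjOrth_apply_eq_iff]
    change (mk (1 : F) 0 0).1 * x.1 * w.1 = _ * ((mk (1 : F) 0 0).1 * x.1)
    have h := polar_detForm x w
    rw [hxw, neg_zero, zero_smul] at h
    rw [mul_assoc, eq_neg_of_add_eq_zero_left h, ← mul_assoc, mul_neg, ← mul_assoc,
      mul_reflectionIn, neg_mul, neg_neg]

/-- The matrix is diag(1, -1) times a matrix of determinant one inducing s. The sign together with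
determinant -1 is what distinguishes this coset from the derived group. -/
theorem exists_mul_eq_neg_of_omegaGroup (h2 : (2 : F) ≠ 0) {s : orthGroup (detForm F)}
    (hs : s ∈ omegaGroup (detForm F)) :
    ∃ h : Matrix (Fin 2) (Fin 2) F, h.det = -1 ∧ ∀ w : Traceless F,
      h * w.1 = -(((reflectionIn (detForm F) (mk 1 0 0) detForm_mk_one_ne_zero * s).1 w).1 * h) := by
  rw [omegaGroup_detForm h2] at hs
  obtain ⟨t, rfl⟩ := hs
  refine ⟨(mk 1 0 0).1 * t.1, ?_, fun w => ?_⟩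
  · rw [Matrix.det_mul, t.2, ← detForm_apply, detForm_mk]; ring
  · have h1 : t.1 * w.1 = ((conjSL F t).1 w).1 * t.1 :=
      conjOrth_apply_eq_iff (h := Matrix.SpecialLinearGroup.toGL t).1 rfl
    rw [mul_assoc, h1, ← mul_assoc, mul_reflectionIn, neg_mul, mul_assoc]
    rfl

/-- Polarised Cayley–Hamilton; the terms containing the trace of w vanish. -/
theorem mul_add_mul (h : Matrix (Fin 2) (Fin 2) F) (w : Traceless F) :
    h * w.1 + w.1 * h = h.trace • w.1 + (h * w.1).trace • (1 : Matrix (Fin 2) (Fin 2) F) := by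
  obtain ⟨a, b, c, rfl⟩ := exists_eq_mk w
  ext i j
  fin_cases i <;> fin_cases j <;>
    simp [mk, Matrix.mul_apply, Matrix.vecMul, dotProduct, Fin.sum_univ_two,
      Matrix.trace_fin_two] <;> ring

/-- Here w = uvᵀ with vᵀu = 0, and wyw = (vᵀyu)w. If this is zero, the row vᵀy annihilates u, so it
is a multiple of vᵀ. The scalar vᵀyu is tr(wy), written out as `ht`. -/
theorem exists_mul_eq_smul {w : Traceless F} (hw : w ≠ 0) (hdet : w.1.det = 0)
    {y : Matrix (Fin 2) (Fin 2) F} (hy : w.1 * y * w.1 = 0) : ∃ α : F, w.1 * y = α • w.1 := by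
  obtain ⟨a, b, c, rfl⟩ := exists_eq_mk w
  rw [← detForm_apply, detForm_mk] at hdet
  have ht : a * (y 0 0 - y 1 1) + b * y 1 0 + c * y 0 1 = 0 := by
    by_contra hne
    apply hw
    have e : (mk a b c).1 * y * (mk a b c).1 =
        (a * (y 0 0 - y 1 1) + b * y 1 0 + c * y 0 1) • (mk a b c).1 := by
      ext i j
      fin_cases i <;> fin_cases j <;>
        simp [mk, Matrix.mul_apply, Matrix.vecMul, dotProduct, Fin.sum_univ_two]
      · linear_combination (-y 1 1) * hdet
      · linear_combination (y 0 1) * hdet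
      · linear_combination (y 1 0) * hdet
      · linear_combination (-y 0 0) * hdet
    rw [hy] at e
    exact Subtype.ext ((smul_eq_zero.1 e.symm).resolve_left hne)
  by_cases hc : c = 0
  · subst hc
    have ha : a = 0 := by simpa using hdet
    subst ha
    have hb : b ≠ 0 := by rintro rfl; exact hw (mk_eq_zero.2 ⟨rfl, rfl, rfl⟩)
    refine ⟨y 1 1, ?_⟩
    have h10 : y 1 0 = 0 := by simpa [hb] using ht
    ext i j
    fin_cases i <;> fin_cases j <;> simp [mk, Matrix.mul_apply, Fin.sum_univ_two, h10, mul_comm]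
  · refine ⟨y 0 0 - a * y 1 0 / c, ?_⟩
    have hb : b = -a ^ 2 / c := by
      rw [eq_div_iff hc]
      linear_combination -hdet
    subst hb
    have h01 : y 0 1 = (-a * (y 0 0 - y 1 1) + a ^ 2 / c * y 1 0) / c := by
      rw [eq_div_iff hc]
      linear_combination ht
    ext i j
    fin_cases i <;> fin_cases j <;> simp [mk, Matrix.mul_apply, Fin.sum_univ_two, h01] <;>
      field_simp <;> ring

/-- If x ≠ 0, both matrices are singular and traceless, hence nilpotent of rank one. The image of x
lies in the kernel of w, so they share the line that is both kernel and image, and such matrices are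
proportional. -/
theorem exists_eq_smul_of_mul_eq_zero {w x : Traceless F} (hw : w ≠ 0) (h : w.1 * x.1 = 0) :
    ∃ c : F, x = c • w := by
  obtain ⟨a, b, c, rfl⟩ := exists_eq_mk w
  obtain ⟨p, q, r, rfl⟩ := exists_eq_mk x
  have h00 : a * p + b * r = 0 := by
    simpa [mk, Matrix.mul_apply, Fin.sum_univ_two] using congrFun (congrFun h 0) 0
  have h01 : a * q - b * p = 0 := by
    simpa [mk, Matrix.mul_apply, Fin.sum_univ_two, sub_eq_add_neg] using congrFun (congrFun h 0) 1
  have h10 : c * p - a * r = 0 := by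
    simpa [mk, Matrix.mul_apply, Fin.sum_univ_two, sub_eq_add_neg] using congrFun (congrFun h 1) 0
  have h11 : c * q + a * p = 0 := by
    simpa [mk, Matrix.mul_apply, Fin.sum_univ_two] using congrFun (congrFun h 1) 1
  have key : ∀ t : F, p = t * a → q = t * b → r = t * c → mk p q r = t • mk a b c := by
    rintro t rfl rfl rfl
    apply Subtype.ext
    ext i j
    fin_cases i <;> fin_cases j <;> simp [mk]
  by_cases ha : a = 0
  · by_cases hb : b = 0
    · have hc : c ≠ 0 := by rintro rfl; exact hw (mk_eq_zero.2 ⟨ha, hb, rfl⟩)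
      refine ⟨r / c, key _ ?_ ?_ ?_⟩ <;> field_simp
      · linear_combination h10
      · linear_combination h11 - r * hb - p * ha
    · refine ⟨q / b, key _ ?_ ?_ ?_⟩ <;> field_simp
      · linear_combination -h01
      · linear_combination h00 - h11
  · refine ⟨p / a, key _ ?_ ?_ ?_⟩ <;> field_simp
    · linear_combination h01
    · linear_combination -h10

/-- Since x² = 1, x has eigenvalues 1 and -1. A nilpotent matrix whose kernel and image are the
1-eigenline anticommutes with x. That line is spanned by any nonzero column of x + 1; the cases use
the first column or the second. -/
theorem exists_singular_orthogonal (h2 : (2 : F) ≠ 0) {x : Traceless F} (hx : x.1.det = -1) :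
    ∃ y : Traceless F, y ≠ 0 ∧ detForm F y = 0 ∧ QuadraticMap.polar (detForm F) x y = 0 := by
  obtain ⟨a, b, c, rfl⟩ := exists_eq_mk x
  rw [← detForm_apply, detForm_mk] at hx
  by_cases h : a + 1 = 0 ∧ c = 0
  · obtain ⟨h1, rfl⟩ := h
    refine ⟨mk (b * (a - 1)) (b ^ 2) (-(a - 1) ^ 2), ?_, ?_, ?_⟩
    · rw [Ne, mk_eq_zero]
      rintro ⟨-, -, h3⟩
      have h4 : a - 1 = 0 := by simpa using h3
      apply h2
      linear_combination h1 - h4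
    · rw [detForm_mk]; ring
    · rw [polar_mk]
      have ha : a = -1 := by linear_combination h1
      subst ha; ring
  · refine ⟨mk ((a + 1) * c) (-(a + 1) ^ 2) (c ^ 2), ?_, ?_, ?_⟩
    · rw [Ne, mk_eq_zero]
      rintro ⟨-, h3, h4⟩
      exact h ⟨by simpa using h3, by simpa using h4⟩
    · rw [detForm_mk]; ring
    · rw [polar_mk]
      linear_combination c * hx

/-- The nontrivial coset of the derived group in the group it generates with the reflection in
`mk 1 0 0` contains no element acting on a subspace `P` of dimension at least two as the identity
modulo a subspace `L` of the radical of `P`, unless `L = 0` and `P` is a hyperbolic plane. -/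
theorem false_of_reflectionIn_mul_sub_mem (h2 : (2 : F) ≠ 0) {s : orthGroup (detForm F)}
    (hs : s ∈ omegaGroup (detForm F)) {P L : Submodule F (Traceless F)}
    (hP : 2 ≤ Module.finrank F P) (hLP : L ≤ P)
    (horth : ∀ l ∈ L, ∀ p ∈ P, QuadraticMap.polar (detForm F) l p = 0)
    (hsub : ∀ p ∈ P,
      (reflectionIn (detForm F) (mk 1 0 0) detForm_mk_one_ne_zero * s).1 p - p ∈ L)
    (hani : L = ⊥ → Module.finrank F P = 2 → ∀ p ∈ P, detForm F p = 0 → p = 0) : False := by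
  obtain ⟨h, hdet, hh⟩ := exists_mul_eq_neg_of_omegaGroup h2 hs
  set g := reflectionIn (detForm F) (mk 1 0 0) detForm_mk_one_ne_zero * s
  -- The failure of h to anticommute with p is measured by gp - p, which lies in L.
  have hadd : ∀ p : Traceless F, h * p.1 + p.1 * h = -((g.1 p - p).1 * h) := by
    intro p
    rw [hh, Submodule.coe_sub, sub_mul]
    abel
  by_cases hL : L = ⊥
  -- With L = 0, h anticommutes with P. The trace of the polarised identity gives tr(hp) = 0, and
  -- then a nonzero p gives tr h = 0, so h is itself a traceless matrix orthogonal to P.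
  · have hcomm : ∀ p ∈ P, h.trace • p.1 + (h * p.1).trace • (1 : Matrix (Fin 2) (Fin 2) F) = 0 := by
      intro p hp
      have h0 := hsub p hp
      rw [hL, Submodule.mem_bot] at h0
      rw [← mul_add_mul, hadd, h0]
      simp
    have htr : ∀ p ∈ P, (h * p.1).trace = 0 := by
      intro p hp
      have h1 := congrArg Matrix.trace (hcomm p hp)
      rw [Matrix.trace_add, Matrix.trace_smul, Matrix.trace_smul, mem_traceless_iff.1 p.2,
        Matrix.trace_one] at h1
      simpa [h2] using h1
    have hPne : P ≠ ⊥ := by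
      rintro rfl
      simp at hP
    obtain ⟨p₀, hp₀, hp₀'⟩ := Submodule.exists_mem_ne_zero_of_ne_bot hPne
    have ht : h.trace = 0 := by
      have h1 := hcomm p₀ hp₀
      rw [htr p₀ hp₀, zero_smul, add_zero] at h1
      refine (smul_eq_zero.1 h1).resolve_right fun h3 => hp₀' (Subtype.ext h3)
    set x : Traceless F := ⟨h, mem_traceless_iff.2 ht⟩ with hx
    have hxdet : x.1.det = -1 := hdet
    have hpol : ∀ p ∈ P, QuadraticMap.polar (detForm F) x p = 0 := by
      intro p hp
      have h1 := polar_detForm x p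
      have h3 := mul_add_mul h p
      rw [htr p hp, ht, zero_smul, zero_smul, add_zero] at h3
      rw [h3, eq_comm] at h1
      simpa using h1
    obtain ⟨y, hy, hyd, hxy⟩ := exists_singular_orthogonal h2 hxdet
    set φ : Traceless F →ₗ[F] F := (detForm F).polarBilin x with hφ
    have hPφ : P ≤ LinearMap.ker φ := fun p hp => hpol p hp
    have hφne : φ ≠ 0 := by
      intro h0
      have h1 : QuadraticMap.polar (detForm F) x x = 0 := LinearMap.congr_fun h0 x
      rw [QuadraticMap.polar_self, detForm_apply, hxdet] at h1
      simp [h2] at h1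
    have hdim : Module.finrank F (Traceless F) ≤ 3 := by
      have h4 := LinearMap.finrank_range_add_finrank_ker (Matrix.traceLinearMap (Fin 2) F F)
      have h5 : LinearMap.range (Matrix.traceLinearMap (Fin 2) F F) = ⊤ := by
        rw [LinearMap.range_eq_top]
        intro c
        exact ⟨!![c, 0; 0, 0], by simp [Matrix.trace_fin_two]⟩
      rw [h5, finrank_top, Module.finrank_self, Module.finrank_matrix] at h4
      simp at h4
      change 1 + Module.finrank F (Traceless F) = 4 at h4
      omega
    have hker : Module.finrank F (LinearMap.ker φ) ≤ 2 := by
      have h6 : LinearMap.ker φ < ⊤ := by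
        rw [lt_top_iff_ne_top, Ne, LinearMap.ker_eq_top]
        exact hφne
      have := Submodule.finrank_lt_finrank_of_lt h6
      rw [finrank_top] at this
      omega
    have hPle := Submodule.finrank_mono hPφ
    -- The plane orthogonal to x contains P and has dimension at most two, so it equals P. It
    -- contains the singular vector y, against anisotropy.
    have hPeq : P = LinearMap.ker φ := Submodule.eq_of_le_of_finrank_le hPφ (by omega)
    refine hy (hani hL (by omega) y ?_ hyd)
    rw [hPeq]
    exact hxy
  · obtain ⟨w, hw, hw0⟩ := Submodule.exists_mem_ne_zero_of_ne_bot hL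
    have hsing : ∀ l ∈ L, l.1.det = 0 := by
      intro l hl
      have h1 := horth l hl l (hLP hl)
      rw [QuadraticMap.polar_self, detForm_apply] at h1
      simpa [h2] using h1
    have hsq : ∀ l ∈ L, l.1 * l.1 = 0 := by
      intro l hl
      rw [sq_eq_neg_det, hsing l hl]
      simp
    have hwp : ∀ p ∈ P, w.1 * p.1 = -(p.1 * w.1) := by
      intro p hp
      have h1 := polar_detForm w p
      rw [horth w hw p hp, neg_zero, zero_smul] at h1
      exact eq_neg_of_add_eq_zero_left h1
    have hwP : ∀ p ∈ P, ∃ β : F, w.1 * p.1 = β • w.1 := by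
      intro p hp
      apply exists_mul_eq_smul hw0 (hsing w hw)
      rw [hwp p hp, neg_mul, mul_assoc, hsq w hw, mul_zero, neg_zero]
    have hwL : ∀ l ∈ L, w.1 * l.1 = 0 := by
      intro l hl
      obtain ⟨β, hβ⟩ := hwP l (hLP hl)
      have h1 : (β * β) • w.1 = 0 := by
        rw [mul_smul, ← hβ, ← smul_mul_assoc, ← hβ, mul_assoc, hsq l hl, mul_zero]
      have h3 : β = 0 := by
        rcases smul_eq_zero.1 h1 with h4 | h4
        · simpa using h4
        · exact absurd (Subtype.ext h4) hw0
      rw [hβ, h3, zero_smul]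
    -- Left multiplication by w kills L, hence the right-hand side of `hadd`. With wh = αw and wp =
    -- βw the result reads 2αβw = 0; α ≠ 0 because h is invertible, and β ≠ 0 for p outside the span
    -- of w.
    have hvan : ∀ p ∈ P, w.1 * h * p.1 + w.1 * p.1 * h = 0 := by
      intro p hp
      rw [mul_assoc, mul_assoc, ← mul_add, hadd, mul_neg, ← mul_assoc, hwL _ (hsub p hp), zero_mul,
        neg_zero]
    obtain ⟨α, hα⟩ : ∃ α : F, w.1 * h = α • w.1 := by
      apply exists_mul_eq_smul hw0 (hsing w hw)
      have h1 := hvan w (hLP hw)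
      rwa [hsq w hw, zero_mul, add_zero] at h1
    have hα0 : α ≠ 0 := by
      rintro rfl
      rw [zero_smul] at hα
      have hu : IsUnit h := by
        rw [Matrix.isUnit_iff_isUnit_det, hdet]
        exact isUnit_one.neg
      exact hw0 (Subtype.ext (hu.mul_left_eq_zero.1 hα))
    obtain ⟨x, hxP, hxw⟩ : ∃ x ∈ P, x ∉ Submodule.span F {w} := by
      by_contra! hcon
      have h1 : P ≤ Submodule.span F {w} := hcon
      have h3 := Submodule.finrank_mono h1
      have h4 := finrank_span_singleton (K := F) hw0
      omega
    obtain ⟨β, hβ⟩ := hwP x hxP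
    have hβ0 : β ≠ 0 := by
      rintro rfl
      rw [zero_smul] at hβ
      obtain ⟨c, rfl⟩ := exists_eq_smul_of_mul_eq_zero hw0 hβ
      exact hxw (Submodule.smul_mem _ _ (Submodule.mem_span_singleton_self w))
    have h5 := hvan x hxP
    rw [hα, hβ, smul_mul_assoc, smul_mul_assoc, hβ, hα, smul_smul, smul_smul, ← add_smul] at h5
    rcases smul_eq_zero.1 h5 with h6 | h6
    · have : 2 * (α * β) = 0 := by linear_combination h6
      simp [h2, hα0, hβ0] at this
    · exact hw0 (Subtype.ext h6)

end Traceless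

end Traceless

/-! ### Witt index -/

section Witt

open QuadraticMap

variable {F V : Type*} [Field F] [AddCommGroup V] [Module F V]

theorem IsTotallySingular.polar_eq_zero {Q : QuadraticForm F V} {N : Submodule F V}
    (hN : IsTotallySingular Q N) {u v : V} (hu : u ∈ N) (hv : v ∈ N) : polar Q u v = 0 := by
  rw [polar, hN _ (add_mem hu hv), hN _ hu, hN _ hv]
  simp

theorem IsTotallySingular.mono {Q : QuadraticForm F V} {M N : Submodule F V}
    (hN : IsTotallySingular Q N) (h : M ≤ N) : IsTotallySingular Q M :=
  fun v hv => hN v (h hv)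

theorem IsTotallySingular.sup_span {Q : QuadraticForm F V} {N : Submodule F V}
    (hN : IsTotallySingular Q N) {v : V} (hv : Q v = 0) (h : ∀ n ∈ N, polar Q n v = 0) :
    IsTotallySingular Q (N ⊔ Submodule.span F {v}) := by
  intro x hx
  obtain ⟨n, hn, y, hy, rfl⟩ := Submodule.mem_sup.1 hx
  obtain ⟨c, rfl⟩ := Submodule.mem_span_singleton.1 hy
  rw [QuadraticMap.map_add Q, hN n hn, QuadraticMap.map_smul, hv, polar_smul_right, h n hn]
  simp

/-- The hyperplane orthogonal to a vector. -/
abbrev vectorPerp (Q : QuadraticForm F V) (v : V) : Submodule F V :=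
  LinearMap.ker (Q.polarBilin v)

theorem mem_vectorPerp {Q : QuadraticForm F V} {u v : V} :
    v ∈ vectorPerp Q u ↔ polar Q u v = 0 := Iff.rfl

theorem mem_perp_span {Q : QuadraticForm F V} {S : Set V} {v : V} :
    v ∈ perp Q (Submodule.span F S) ↔ ∀ s ∈ S, polar Q s v = 0 := by
  constructor
  · intro h s hs
    exact h s (Submodule.subset_span hs)
  · intro h w hw
    have : Submodule.span F S ≤ vectorPerp Q v := by
      rw [Submodule.span_le]
      intro s hs
      rw [SetLike.mem_coe, mem_vectorPerp, polar_comm]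
      exact h s hs
    rw [polar_comm]
    exact this hw

theorem finrank_map_add_finrank_inf_ker {V' : Type*} [AddCommGroup V'] [Module F V']
    [FiniteDimensional F V] (N : Submodule F V) (φ : V →ₗ[F] V') :
    Module.finrank F (N.map φ) + Module.finrank F ↥(N ⊓ LinearMap.ker φ) = Module.finrank F N := by
  have h1 := LinearMap.finrank_range_add_finrank_ker (φ.domRestrict N)
  have h3 : Module.finrank F (LinearMap.ker (φ.domRestrict N)) =
      Module.finrank F ↥(N ⊓ LinearMap.ker φ) := by
    rw [← Submodule.map_comap_subtype, Submodule.finrank_map_subtype_eq]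
    rfl
  rwa [LinearMap.range_domRestrict, h3] at h1

theorem finrank_inf_ker_add_one [FiniteDimensional F V] {N : Submodule F V} {φ : V →ₗ[F] F} {x : V} (hx : x ∈ N)
    (hφ : φ x ≠ 0) : Module.finrank F ↥(N ⊓ LinearMap.ker φ) + 1 = Module.finrank F N := by
  have h1 := finrank_map_add_finrank_inf_ker N φ
  have h2 : N.map φ = ⊤ := by
    rw [eq_top_iff]
    intro c _
    refine ⟨(c / φ x) • x, Submodule.smul_mem _ _ hx, ?_⟩
    rw [map_smul, smul_eq_mul, div_mul_cancel₀ _ hφ]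
  rw [h2, finrank_top, Module.finrank_self] at h1
  omega

theorem finrank_le_inf_ker_add_one [FiniteDimensional F V] (N : Submodule F V) (φ : V →ₗ[F] F) :
    Module.finrank F N ≤ Module.finrank F ↥(N ⊓ LinearMap.ker φ) + 1 := by
  by_cases h : N ≤ LinearMap.ker φ
  · rw [inf_eq_left.2 h]
    omega
  · obtain ⟨x, hx, hx'⟩ := SetLike.not_le_iff_exists.1 h
    exact (finrank_inf_ker_add_one hx hx').ge

theorem finrank_sup_span_singleton [FiniteDimensional F V] {N : Submodule F V} {v : V} (hv : v ∉ N) :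
    Module.finrank F ↥(N ⊔ Submodule.span F {v}) = Module.finrank F N + 1 := by
  have h1 := Submodule.finrank_sup_add_finrank_inf_eq N (Submodule.span F {v})
  have hv0 : v ≠ 0 := by
    rintro rfl
    exact hv (zero_mem N)
  have h2 : N ⊓ Submodule.span F {v} = ⊥ := by
    rw [eq_bot_iff]
    rintro x ⟨hx, hx'⟩
    obtain ⟨c, rfl⟩ := Submodule.mem_span_singleton.1 hx'
    by_cases hc : c = 0
    · simp [hc]
    · exact absurd ((Submodule.smul_mem_iff N hc).1 hx) hv
  rw [h2, finrank_bot, finrank_span_singleton hv0] at h1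
  omega

/-! ### Witt index of restrictions and hyperbolic pairs. -/

theorem wittIndex_bddAbove [FiniteDimensional F V] (Q : QuadraticForm F V) :
    BddAbove {k | ∃ N : Submodule F V, IsTotallySingular Q N ∧ Module.finrank F N = k} := by
  refine ⟨Module.finrank F V, ?_⟩
  rintro _ ⟨N, -, rfl⟩
  exact Submodule.finrank_le N

theorem finrank_le_wittIndex [FiniteDimensional F V] {Q : QuadraticForm F V} {N : Submodule F V}
    (hN : IsTotallySingular Q N) : Module.finrank F N ≤ wittIndex Q :=
  le_csSup (wittIndex_bddAbove Q) ⟨N, hN, rfl⟩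

theorem exists_finrank_eq_wittIndex [FiniteDimensional F V] (Q : QuadraticForm F V) :
    ∃ N : Submodule F V, IsTotallySingular Q N ∧ Module.finrank F N = wittIndex Q :=
  Nat.sSup_mem (s := {k | ∃ N : Submodule F V, IsTotallySingular Q N ∧ Module.finrank F N = k})
    ⟨0, ⊥, fun v hv => by rw [(Submodule.mem_bot F).1 hv, QuadraticMap.map_zero], finrank_bot F V⟩
    (wittIndex_bddAbove Q)

theorem finrank_le_wittIndex_restrictForm [FiniteDimensional F V] {Q : QuadraticForm F V} {N X : Submodule F V}
    (hN : IsTotallySingular Q N) (hNX : N ≤ X) :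
    Module.finrank F N ≤ wittIndex (restrictForm Q X) := by
  have h : IsTotallySingular (restrictForm Q X) (N.comap X.subtype) := fun v hv => hN _ hv
  have h1 := finrank_le_wittIndex h
  rwa [← Submodule.finrank_map_subtype_eq, Submodule.map_comap_subtype, inf_eq_right.2 hNX] at h1

theorem exists_finrank_eq_wittIndex_restrictForm [FiniteDimensional F V] (Q : QuadraticForm F V) (X : Submodule F V) :
    ∃ N ≤ X, IsTotallySingular Q N ∧ Module.finrank F N = wittIndex (restrictForm Q X) := by
  obtain ⟨N, hN, h⟩ := exists_finrank_eq_wittIndex (restrictForm Q X)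
  refine ⟨N.map X.subtype, Submodule.map_subtype_le X N, ?_, ?_⟩
  · rintro _ ⟨v, hv, rfl⟩
    exact hN v hv
  · rw [Submodule.finrank_map_subtype_eq, h]

theorem wittIndex_restrictForm_top [FiniteDimensional F V] (Q : QuadraticForm F V) :
    wittIndex (restrictForm Q ⊤) = wittIndex Q := by
  apply le_antisymm
  · obtain ⟨N, -, hN, h⟩ := exists_finrank_eq_wittIndex_restrictForm Q ⊤
    rw [← h]
    exact finrank_le_wittIndex hN
  · obtain ⟨N, hN, h⟩ := exists_finrank_eq_wittIndex Q
    rw [← h]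
    exact finrank_le_wittIndex_restrictForm hN le_top

/-- A hyperbolic pair of a quadratic form. -/
structure IsHyperbolicPair (Q : QuadraticForm F V) (e f : V) : Prop where
  left : Q e = 0
  right : Q f = 0
  polar_eq_one : polar Q e f = 1

/-- Splitting off a hyperbolic pair lowers the Witt index by one. -/
theorem wittIndex_restrictForm_of_hyperbolic [FiniteDimensional F V] {Q : QuadraticForm F V} {X : Submodule F V} {e f : V}
    (h : IsHyperbolicPair Q e f) (he : e ∈ X) :
    wittIndex (restrictForm Q X) =
      wittIndex (restrictForm Q (X ⊓ vectorPerp Q e ⊓ vectorPerp Q f)) + 1 := by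
  have hfe : polar Q f e = 1 := by rw [polar_comm, h.polar_eq_one]
  apply le_antisymm
  · obtain ⟨N, hNX, hN, hrank⟩ := exists_finrank_eq_wittIndex_restrictForm Q X
    rw [← hrank]
    -- N is replaced by a totally singular M of no smaller dimension that contains e and lies in its
    -- perp. Cutting M by the perp of f then costs at most one dimension and lands in the complement
    -- of the pair.
    set M := N ⊓ vectorPerp Q e ⊔ Submodule.span F {e} with hM
    have hMts : IsTotallySingular Q M := by
      refine (hN.mono inf_le_left).sup_span h.left fun n hn => ?_
      rw [polar_comm]
      exact hn.2
    have hNM : Module.finrank F N ≤ Module.finrank F M := by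
      by_cases heN : e ∈ N
      · apply Submodule.finrank_mono
        refine le_trans ?_ le_sup_left
        exact fun n hn => ⟨hn, hN.polar_eq_zero heN hn⟩
      · rw [hM, finrank_sup_span_singleton fun hmem : e ∈ N ⊓ vectorPerp Q e => heN hmem.1]
        exact finrank_le_inf_ker_add_one N _
    have hMX : M ⊓ vectorPerp Q f ≤ X ⊓ vectorPerp Q e ⊓ vectorPerp Q f := by
      apply inf_le_inf_right
      rw [hM, sup_le_iff, Submodule.span_singleton_le_iff_mem]
      refine ⟨inf_le_inf_right _ hNX, he, ?_⟩
      change polar Q e e = 0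
      rw [polar_self, h.left, smul_zero]
    calc Module.finrank F N ≤ Module.finrank F M := hNM
      _ ≤ Module.finrank F ↥(M ⊓ vectorPerp Q f) + 1 := finrank_le_inf_ker_add_one M _
      _ ≤ _ := Nat.succ_le_succ
        (finrank_le_wittIndex_restrictForm (hMts.mono inf_le_left) hMX)
  · obtain ⟨N, hNX, hN, hrank⟩ := exists_finrank_eq_wittIndex_restrictForm Q
      (X ⊓ vectorPerp Q e ⊓ vectorPerp Q f)
    have heN : e ∉ N := by
      intro hmem
      have : polar Q f e = 0 := (hNX hmem).2
      rw [hfe] at this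
      exact one_ne_zero this
    rw [← hrank, ← finrank_sup_span_singleton heN]
    apply finrank_le_wittIndex_restrictForm
    · refine hN.sup_span h.left fun n hn => ?_
      rw [polar_comm]
      exact (hNX hn).1.2
    · rw [sup_le_iff, Submodule.span_singleton_le_iff_mem]
      exact ⟨hNX.trans (inf_le_left.trans inf_le_left), he⟩

/-! ### Nondegenerate subspaces. -/

/-- Nondegeneracy of the restriction of a form to a subspace. -/
def NondegenerateOn (Q : QuadraticForm F V) (X : Submodule F V) : Prop :=
  ∀ v ∈ X, (∀ u ∈ X, polar Q u v = 0) → v = 0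

theorem NondegenerateOn.isNondegenerate {Q : QuadraticForm F V} {X : Submodule F V}
    (h : NondegenerateOn Q X) : IsNondegenerate (restrictForm Q X) := by
  intro v hv
  apply Subtype.ext
  exact h v v.2 fun u hu => hv ⟨u, hu⟩

theorem IsNondegenerate.nondegenerateOn_top {Q : QuadraticForm F V} (h : IsNondegenerate Q) :
    NondegenerateOn Q ⊤ :=
  fun v _ hv => h v fun u => hv u Submodule.mem_top

theorem NondegenerateOn.exists_hyperbolic {Q : QuadraticForm F V} {X : Submodule F V}
    (h : NondegenerateOn Q X) {e : V} (he : e ∈ X) (he0 : e ≠ 0) (hQe : Q e = 0) :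
    ∃ f ∈ X, IsHyperbolicPair Q e f := by
  obtain ⟨u, hu, hue⟩ : ∃ u ∈ X, polar Q u e ≠ 0 := by
    by_contra! hcon
    exact he0 (h e he hcon)
  rw [polar_comm] at hue
  obtain ⟨u', hu', h1⟩ : ∃ u' ∈ X, polar Q e u' = 1 :=
    ⟨(polar Q e u)⁻¹ • u, Submodule.smul_mem _ _ hu, by
      rw [polar_smul_right, smul_eq_mul, inv_mul_cancel₀ hue]⟩
  -- Since e is singular and pairs to 1 with u', subtracting Q(u')e cancels the value at u' without
  -- changing its pairing with e.
  refine ⟨u' + (-Q u') • e, add_mem hu' (Submodule.smul_mem _ _ he),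
    hQe, ?_, ?_⟩
  · rw [QuadraticMap.map_add Q, QuadraticMap.map_smul, hQe, polar_smul_right, polar_comm, h1]
    simp
  · rw [polar_add_right, h1, polar_smul_right, polar_self, hQe]
    simp

theorem NondegenerateOn.inf_hyperbolic {Q : QuadraticForm F V} {X : Submodule F V}
    (h : NondegenerateOn Q X) {e f : V} (hef : IsHyperbolicPair Q e f) (he : e ∈ X) (hf : f ∈ X) :
    NondegenerateOn Q (X ⊓ vectorPerp Q e ⊓ vectorPerp Q f) := by
  rintro v ⟨⟨hvX, hve⟩, hvf⟩ hv
  replace hvf : polar Q f v = 0 := hvf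
  replace hve : polar Q e v = 0 := hve
  refine h v hvX fun u hu => ?_
  have hfe : polar Q f e = 1 := by rw [polar_comm, hef.polar_eq_one]
  have hee : polar Q e e = 0 := by rw [polar_self, hef.left, smul_zero]
  have hff : polar Q f f = 0 := by rw [polar_self, hef.right, smul_zero]
  -- The test vector is the component of u orthogonal to the pair; v pairs with it as it does with
  -- u.
  have key := hv (u + (-polar Q f u) • e + (-polar Q e u) • f) (by
    refine ⟨⟨add_mem (add_mem hu (Submodule.smul_mem _ _ he)) (Submodule.smul_mem _ _ hf), ?_⟩, ?_⟩
    · change polar Q e _ = 0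
      simp only [polar_add_right, polar_smul_right, hee, hef.polar_eq_one]
      simp
    · change polar Q f _ = 0
      simp only [polar_add_right, polar_smul_right, hff, hfe]
      simp)
  simpa only [polar_add_left, polar_smul_left, hve, hvf, smul_zero, add_zero] using key

theorem finrank_inf_hyperbolic [FiniteDimensional F V] {Q : QuadraticForm F V} {X : Submodule F V} {e f : V}
    (hef : IsHyperbolicPair Q e f) (he : e ∈ X) (hf : f ∈ X) :
    Module.finrank F ↥(X ⊓ vectorPerp Q e ⊓ vectorPerp Q f) + 2 = Module.finrank F X := by
  have hfe : polar Q f e = 1 := by rw [polar_comm, hef.polar_eq_one]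
  have h1 : Module.finrank F ↥(X ⊓ vectorPerp Q e) + 1 = _ := finrank_inf_ker_add_one hf (by
    rw [polarBilin_apply_apply, hef.polar_eq_one]; exact one_ne_zero)
  have h2 : Module.finrank F ↥(X ⊓ vectorPerp Q e ⊓ vectorPerp Q f) + 1 = _ :=
    finrank_inf_ker_add_one (x := e)
    ⟨he, mem_vectorPerp.2 (by rw [polar_self, hef.left, smul_zero])⟩ (by
      rw [polarBilin_apply_apply, hfe]; exact one_ne_zero)
  omega

theorem finrank_inf_vectorPerp [FiniteDimensional F V] (h2 : (2 : F) ≠ 0) {Q : QuadraticForm F V} {X : Submodule F V}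
    {z : V} (hz : z ∈ X) (hQz : Q z ≠ 0) :
    Module.finrank F ↥(X ⊓ vectorPerp Q z) + 1 = Module.finrank F X := by
  apply finrank_inf_ker_add_one hz
  rw [polarBilin_apply_apply, polar_self, two_nsmul, ← two_mul]
  exact mul_ne_zero h2 hQz

theorem NondegenerateOn.inf_vectorPerp (h2 : (2 : F) ≠ 0) {Q : QuadraticForm F V}
    {X : Submodule F V} (h : NondegenerateOn Q X) {z : V} (hz : z ∈ X) (hQz : Q z ≠ 0) :
    NondegenerateOn Q (X ⊓ vectorPerp Q z) := by
  rintro v ⟨hvX, hvz⟩ hv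
  replace hvz : polar Q z v = 0 := hvz
  refine h v hvX fun u hu => ?_
  have key := hv (u + (-(polar Q z u / (2 * Q z))) • z) (by
    refine ⟨add_mem hu (Submodule.smul_mem _ _ hz), ?_⟩
    change polar Q z _ = 0
    rw [polar_add_right, polar_smul_right, polar_self, two_nsmul, smul_eq_mul]
    field_simp
    ring)
  simpa only [polar_add_left, polar_smul_left, hvz, smul_zero, add_zero] using key

/-! ### Finite fields of odd order and elliptic hyperplanes. -/

theorem two_ne_zero_of_odd_card [Finite F] (hF : Odd (Nat.card F)) : (2 : F) ≠ 0 := by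
  have := Fintype.ofFinite F
  intro h
  have h1 : ringChar F = 2 := by
    have h3 : ringChar F ∣ 2 := by
      rw [← ringChar.spec]
      exact_mod_cast h
    rcases (Nat.dvd_prime Nat.prime_two).1 h3 with h4 | h4
    · exact absurd h4 (CharP.ringChar_ne_one)
    · exact h4
  have h5 := FiniteField.even_card_of_char_two h1
  rw [Nat.card_eq_fintype_card, Nat.odd_iff] at hF
  omega

/-- An anisotropic X would contain three mutually orthogonal nonsingular vectors x, y, w. The
equation Q(x)a² + Q(y)b² + Q(w) = 0 is solvable by counting: each of Q(x)a² + Q(w) and -Q(y)b² takes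
more than half of the values in the field. -/
theorem exists_singular_of_three_le_finrank [Finite F] [FiniteDimensional F V]
    (hF : Odd (Nat.card F)) (Q : QuadraticForm F V)
    {X : Submodule F V} (hX : 3 ≤ Module.finrank F X) : ∃ v ∈ X, v ≠ 0 ∧ Q v = 0 := by
  have := Fintype.ofFinite F
  by_contra! hcon
  have hexists : ∀ N : Submodule F V, N ≤ X → 1 ≤ Module.finrank F N →
      ∃ x ∈ N, x ≠ 0 ∧ Q x ≠ 0 := by
    intro N hN h1
    have : N ≠ ⊥ := by
      rintro rfl
      simp at h1
    obtain ⟨x, hx, hx0⟩ := Submodule.exists_mem_ne_zero_of_ne_bot this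
    exact ⟨x, hx, hx0, hcon x (hN hx) hx0⟩
  obtain ⟨x, hx, -, hQx⟩ := hexists X le_rfl (by omega)
  have h1 : _ ≤ Module.finrank F ↥(X ⊓ vectorPerp Q x) + 1 := finrank_le_inf_ker_add_one X _
  obtain ⟨y, hy, -, hQy⟩ := hexists (X ⊓ vectorPerp Q x) inf_le_left (by omega)
  have h2 : _ ≤ Module.finrank F ↥(X ⊓ vectorPerp Q x ⊓ vectorPerp Q y) + 1 :=
    finrank_le_inf_ker_add_one _ _
  obtain ⟨w, hw, hw0, hQw⟩ := hexists (X ⊓ vectorPerp Q x ⊓ vectorPerp Q y)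
    (inf_le_left.trans inf_le_left) (by omega)
  have hxy : polar Q x y = 0 := hy.2
  have hxw : polar Q x w = 0 := hw.1.2
  have hyw : polar Q y w = 0 := hw.2
  obtain ⟨a, b, hab⟩ := FiniteField.exists_root_sum_quadratic
    (f := Polynomial.C (Q x) * Polynomial.X ^ 2 + Polynomial.C 0 * Polynomial.X +
      Polynomial.C (Q w))
    (g := Polynomial.C (Q y) * Polynomial.X ^ 2 + Polynomial.C 0 * Polynomial.X +
      Polynomial.C 0)
    (Polynomial.degree_quadratic hQx) (Polynomial.degree_quadratic hQy)
    (by rwa [← Nat.card_eq_fintype_card, ← Nat.odd_iff])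
  simp only [Polynomial.eval_add, Polynomial.eval_mul, Polynomial.eval_C, Polynomial.eval_pow,
    Polynomial.eval_X] at hab
  refine hcon (a • x + b • y + w) (add_mem (add_mem (Submodule.smul_mem _ _ hx)
    (Submodule.smul_mem _ _ hy.1)) hw.1.1) ?_ ?_
  -- The vector is nonzero because its pairing with w is 2Q(w).
  · intro h0
    have h3 : polar Q (a • x + b • y + w) w = 0 := by
      rw [h0, polar_zero_left]
    rw [polar_add_left, polar_add_left, polar_smul_left, polar_smul_left, hxw, hyw, polar_self,
      two_nsmul, smul_zero, smul_zero, zero_add, zero_add, ← two_mul] at h3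
    exact mul_ne_zero (two_ne_zero_of_odd_card hF) hQw h3
  · rw [QuadraticMap.map_add Q, QuadraticMap.map_add Q, polar_add_left, polar_smul_left,
      polar_smul_left, polar_smul_left, polar_smul_right, hxy, hxw, hyw, QuadraticMap.map_smul,
      QuadraticMap.map_smul]
    simp only [smul_eq_mul]
    linear_combination hab

theorem NondegenerateOn.exists_hyperbolic_of_three_le_finrank [Finite F] [FiniteDimensional F V]
    (hF : Odd (Nat.card F))
    {Q : QuadraticForm F V} {X : Submodule F V} (h : NondegenerateOn Q X)
    (hX : 3 ≤ Module.finrank F X) : ∃ e ∈ X, ∃ f ∈ X, IsHyperbolicPair Q e f := by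
  obtain ⟨e, he, he0, hQe⟩ := exists_singular_of_three_le_finrank hF Q hX
  obtain ⟨f, hf, hef⟩ := h.exists_hyperbolic he he0 hQe
  exact ⟨e, he, f, hf, hef⟩

/-- The Witt index of a nondegenerate form in dimension `2d + 1` over a finite field. -/
theorem NondegenerateOn.wittIndex_eq [Finite F] [FiniteDimensional F V]
    (hF : Odd (Nat.card F)) {Q : QuadraticForm F V} (d : ℕ)
    {X : Submodule F V} (h : NondegenerateOn Q X) (hX : Module.finrank F X = 2 * d + 1) :
    wittIndex (restrictForm Q X) = d := by
  induction d generalizing X with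
  | zero =>
    by_contra hne
    obtain ⟨N, hNX, hN, hrank⟩ := exists_finrank_eq_wittIndex_restrictForm Q X
    have hle := Submodule.finrank_mono hNX
    obtain rfl : N = X := Submodule.eq_of_le_of_finrank_le hNX (by omega)
    have : N ≠ ⊥ := by
      rintro rfl
      simp at hX
    obtain ⟨x, hx, hx0⟩ := Submodule.exists_mem_ne_zero_of_ne_bot this
    exact hx0 (h x hx fun u hu => hN.polar_eq_zero hu hx)
  | succ d ih =>
    obtain ⟨e, he, f, hf, hef⟩ := h.exists_hyperbolic_of_three_le_finrank hF (by omega)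
    rw [wittIndex_restrictForm_of_hyperbolic hef he, ih (h.inf_hyperbolic hef he hf)]
    have := finrank_inf_hyperbolic hef he hf
    omega

theorem exists_nonsquare_of_odd_card [Finite F] (hF : Odd (Nat.card F)) : ∃ ν : F, ¬ IsSquare ν := by
  have := Fintype.ofFinite F
  apply FiniteField.exists_nonsquare
  intro h
  have h5 := FiniteField.even_card_of_char_two h
  rw [Nat.card_eq_fintype_card, Nat.odd_iff] at hF
  omega

/-- Write X as a hyperbolic plane ⟨e, f⟩ plus an orthogonal line ⟨y⟩ and take z = e + Q(y)νf with ν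
a nonsquare. A singular vector cy + be + af in the perp of z has a = -Q(y)νb and c²Q(y) + ab = 0, so
c² = νb², which forces it to vanish. -/
theorem NondegenerateOn.exists_elliptic_hyperplane_of_finrank_eq_three [Finite F]
    [FiniteDimensional F V] (hF : Odd (Nat.card F)) {Q : QuadraticForm F V} {X : Submodule F V}
    (h : NondegenerateOn Q X) (hX : Module.finrank F X = 3) :
    ∃ z ∈ X, Q z ≠ 0 ∧ wittIndex (restrictForm Q (X ⊓ vectorPerp Q z)) = 0 := by
  obtain ⟨e, he, f, hf, hef⟩ := h.exists_hyperbolic_of_three_le_finrank hF (by omega)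
  have hrank := finrank_inf_hyperbolic hef he hf
  have hnd := h.inf_hyperbolic hef he hf
  have hfe : polar Q f e = 1 := by rw [polar_comm, hef.polar_eq_one]
  have hee : polar Q e e = 0 := by rw [polar_self, hef.left, smul_zero]
  have hff : polar Q f f = 0 := by rw [polar_self, hef.right, smul_zero]
  set X' := X ⊓ vectorPerp Q e ⊓ vectorPerp Q f with hX'
  obtain ⟨y, hy, hQy⟩ : ∃ y ∈ X', Q y ≠ 0 := by
    by_contra! hcon
    have h3 := finrank_le_wittIndex_restrictForm (Q := Q) hcon (le_refl X')
    rw [hnd.wittIndex_eq hF 0 (by omega)] at h3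
    omega
  have hy0 : y ≠ 0 := by
    rintro rfl
    exact hQy (QuadraticMap.map_zero Q)
  obtain ⟨ν, hν⟩ := exists_nonsquare_of_odd_card hF
  have hν0 : ν ≠ 0 := by
    rintro rfl
    exact hν (IsSquare.zero)
  have hQz : Q (e + (Q y * ν) • f) = Q y * ν := by
    rw [QuadraticMap.map_add Q, QuadraticMap.map_smul, hef.left, hef.right, polar_smul_right,
      hef.polar_eq_one]
    simp
  refine ⟨e + (Q y * ν) • f, add_mem he (Submodule.smul_mem _ _ hf), ?_, ?_⟩
  · rw [hQz]
    exact mul_ne_zero hQy hν0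
  · by_contra hne
    obtain ⟨N, hNX, hN, hNrank⟩ := exists_finrank_eq_wittIndex_restrictForm Q
      (X ⊓ vectorPerp Q (e + (Q y * ν) • f))
    have hNbot : N ≠ ⊥ := by
      rintro rfl
      simp at hNrank
      omega
    obtain ⟨v, hv, hv0⟩ := Submodule.exists_mem_ne_zero_of_ne_bot hNbot
    have hspan : X' = Submodule.span F {y} := by
      symm
      apply Submodule.eq_of_le_of_finrank_le
      · rwa [Submodule.span_singleton_le_iff_mem]
      · rw [finrank_span_singleton hy0]
        omega
    set a := polar Q e v with ha
    set b := polar Q f v with hb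
    have hvX' : v + (-b) • e + (-a) • f ∈ X' := by
      refine ⟨⟨add_mem (add_mem (hNX hv).1 (Submodule.smul_mem _ _ he))
        (Submodule.smul_mem _ _ hf), ?_⟩, ?_⟩
      · change polar Q e _ = 0
        simp only [polar_add_right, polar_smul_right, hee, hef.polar_eq_one]
        simp [ha]
      · change polar Q f _ = 0
        simp only [polar_add_right, polar_smul_right, hff, hfe]
        simp [hb]
    rw [hspan, Submodule.mem_span_singleton] at hvX'
    obtain ⟨c, hc⟩ := hvX'
    have hey : polar Q e y = 0 := hy.1.2
    have hfy : polar Q f y = 0 := hy.2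
    have hv' : v = c • y + b • e + a • f := by
      rw [hc]
      module
    have hperp : a + Q y * ν * b = 0 := by
      have h3 : polar Q (e + (Q y * ν) • f) v = 0 := (hNX hv).2
      rwa [polar_add_left, polar_smul_left, smul_eq_mul] at h3
    have hQv : c ^ 2 * Q y + a * b = 0 := by
      have h3 := hN v hv
      rw [hv', QuadraticMap.map_add Q, QuadraticMap.map_add Q, polar_add_left, polar_smul_left,
        polar_smul_left, polar_smul_left, polar_smul_right, polar_smul_right, polar_smul_right,
        polar_comm Q y e, polar_comm Q y f, hey, hfy, hef.polar_eq_one, QuadraticMap.map_smul,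
        QuadraticMap.map_smul, QuadraticMap.map_smul, hef.left, hef.right] at h3
      simp only [smul_eq_mul] at h3
      linear_combination h3
    have hcb : c ^ 2 = ν * b ^ 2 := by
      apply mul_right_cancel₀ hQy
      linear_combination hQv - b * hperp
    by_cases hb0 : b = 0
    · have hc0 : c = 0 := by
        rw [hb0] at hcb
        simpa using hcb
      have ha0 : a = 0 := by
        rw [hb0] at hperp
        simpa using hperp
      apply hv0
      rw [hv', hc0, hb0, ha0]
      simp
    · apply hν
      refine ⟨c / b, ?_⟩
      field_simp
      linear_combination -hcb

/-- A nondegenerate form of odd dimension at least three over a finite field has a hyperplane of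
elliptic type. -/
theorem NondegenerateOn.exists_elliptic_hyperplane [Finite F] [FiniteDimensional F V]
    (hF : Odd (Nat.card F)) {Q : QuadraticForm F V} (d : ℕ) {X : Submodule F V}
    (h : NondegenerateOn Q X) (hX : Module.finrank F X = 2 * (d + 1) + 1) :
    ∃ z ∈ X, Q z ≠ 0 ∧ wittIndex (restrictForm Q (X ⊓ vectorPerp Q z)) = d := by
  induction d generalizing X with
  | zero => exact h.exists_elliptic_hyperplane_of_finrank_eq_three hF hX
  | succ d ih =>
    obtain ⟨e, he, f, hf, hef⟩ := h.exists_hyperbolic_of_three_le_finrank hF (by omega)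
    have hrank := finrank_inf_hyperbolic hef he hf
    obtain ⟨z, hz, hQz, hind⟩ := ih (h.inf_hyperbolic hef he hf) (by omega)
    refine ⟨z, hz.1.1, hQz, ?_⟩
    rw [wittIndex_restrictForm_of_hyperbolic (X := X ⊓ vectorPerp Q z) hef
      ⟨he, mem_vectorPerp.2 (by rw [polar_comm]; exact hz.1.2)⟩,
      inf_right_comm X (vectorPerp Q z), inf_right_comm _ (vectorPerp Q z) (vectorPerp Q f), hind]

/-! ### Existence of frames. -/

theorem perp_frameSpace (Q : QuadraticForm F V) (z e f : V) :
    perp Q (frameSpace F z e f) = ⊤ ⊓ vectorPerp Q z ⊓ vectorPerp Q e ⊓ vectorPerp Q f := by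
  ext v
  rw [frameSpace, mem_perp_span]
  simp [and_assoc]

theorem exists_isFrame [Finite F] [FiniteDimensional F V] (hF : Odd (Nat.card F)) {d : ℕ}
    (hd : 2 ≤ d) (hV : Module.finrank F V = 2 * d + 1) {Q : QuadraticForm F V}
    (hQ : IsNondegenerate Q) : ∃ z e f : V, IsFrame Q z e f := by
  have h2 := two_ne_zero_of_odd_card hF
  obtain ⟨d, rfl⟩ := Nat.exists_eq_add_of_le' hd
  have hQ' := hQ.nondegenerateOn_top
  -- The former d is now d + 2. The perp of z has dimension 2(d + 2) and Witt index d + 1; splitting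
  -- off a hyperbolic pair lowers these by two and by one, so the type remains elliptic.
  obtain ⟨z, hz, hQz, hind⟩ := hQ'.exists_elliptic_hyperplane hF (d + 1)
    (by rw [finrank_top, hV])
  have hrank := finrank_inf_vectorPerp h2 hz hQz
  rw [finrank_top] at hrank
  have hnd := hQ'.inf_vectorPerp h2 hz hQz
  obtain ⟨e, he, f, hf, hef⟩ := hnd.exists_hyperbolic_of_three_le_finrank hF (by omega)
  refine ⟨z, e, f, hQz, hef.left, hef.right, hef.polar_eq_one, he.2, hf.2, ?_⟩
  rw [perp_frameSpace]
  have h3 := wittIndex_restrictForm_of_hyperbolic hef he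
  have h4 := finrank_inf_hyperbolic hef he hf
  exact ⟨(hnd.inf_hyperbolic hef he hf).isNondegenerate, by omega⟩

end Witt

/-! ### Similitudes and orthogonal groups -/

section Congr

open QuadraticMap

variable {F V V' : Type*} [Field F] [AddCommGroup V] [Module F V] [AddCommGroup V'] [Module F V']
  {Q : QuadraticForm F V} {Q' : QuadraticForm F V'}

theorem reflectionIn_apply (Q : QuadraticForm F V) {z : V} (hz : Q z ≠ 0) (v : V) :
    (reflectionIn Q z hz).1 v = v - ((Q z)⁻¹ * polar Q z v) • z := rfl

theorem reflectionIn_mul_self (Q : QuadraticForm F V) {z : V} (hz : Q z ≠ 0) :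
    reflectionIn Q z hz * reflectionIn Q z hz = 1 := by
  apply Subtype.ext
  ext1 v
  change (reflectionIn Q z hz).1 ((reflectionIn Q z hz).1 v) = v
  rw [reflectionIn_apply, reflectionIn_apply, polar_sub_right, polar_smul_right, polar_self,
    two_nsmul, smul_eq_mul, sub_sub, ← add_smul, sub_eq_self]
  rw [show (Q z)⁻¹ * polar Q z v + (Q z)⁻¹ * (polar Q z v - (Q z)⁻¹ * polar Q z v * (Q z + Q z)) = 0
    by field_simp; ring, zero_smul]

/-- A similitude conjugates orthogonal groups into each other. -/
def orthGroupCongr (φ : V ≃ₗ[F] V') {c : F} (hc : c ≠ 0) (hφ : ∀ v, Q' (φ v) = c * Q v) :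
    orthGroup Q ≃* orthGroup Q' where
  toFun g := ⟨(φ.symm.trans g.1).trans φ, fun v => by
    change Q' (φ (g.1 (φ.symm v))) = Q' v
    rw [hφ, g.2, ← hφ, φ.apply_symm_apply]⟩
  invFun g := ⟨(φ.trans g.1).trans φ.symm, fun v => by
    change Q (φ.symm (g.1 (φ v))) = Q v
    apply mul_left_cancel₀ hc
    rw [← hφ, ← hφ, φ.apply_symm_apply, g.2]⟩
  left_inv g := by
    apply Subtype.ext
    ext1 v
    simp
  right_inv g := by
    apply Subtype.ext
    ext1 v
    simp
  map_mul' g k := by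
    apply Subtype.ext
    ext1 v
    change φ (g.1 (k.1 (φ.symm v))) = φ (g.1 (φ.symm (φ (k.1 (φ.symm v)))))
    rw [φ.symm_apply_apply]

variable {φ : V ≃ₗ[F] V'} {c : F} (hc : c ≠ 0) (hφ : ∀ v, Q' (φ v) = c * Q v)

theorem orthGroupCongr_apply (g : orthGroup Q) (v : V) :
    (orthGroupCongr φ hc hφ g).1 (φ v) = φ (g.1 v) := by
  change φ (g.1 (φ.symm (φ v))) = φ (g.1 v)
  rw [φ.symm_apply_apply]

theorem map_omegaGroup_orthGroupCongr :
    (omegaGroup Q).map (orthGroupCongr φ hc hφ).toMonoidHom = omegaGroup Q' := by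
  rw [omegaGroup, omegaGroup, commutator_def, commutator_def, Subgroup.map_commutator,
    Subgroup.map_top_of_surjective _ (orthGroupCongr φ hc hφ).surjective]

theorem orthGroupCongr_mem_omegaGroup {g : orthGroup Q} (hg : g ∈ omegaGroup Q) :
    orthGroupCongr φ hc hφ g ∈ omegaGroup Q' := by
  rw [← map_omegaGroup_orthGroupCongr hc hφ]
  exact Subgroup.mem_map_of_mem _ hg

theorem polar_similitude (hφ : ∀ v, Q' (φ v) = c * Q v) (u v : V) : polar Q' (φ u) (φ v) = c * polar Q u v := by
  rw [polar, polar, ← map_add, hφ, hφ, hφ]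
  ring

theorem orthGroupCongr_reflectionIn {z : V} (hz : Q z ≠ 0) (hz' : Q' (φ z) ≠ 0) :
    orthGroupCongr φ hc hφ (reflectionIn Q z hz) = reflectionIn Q' (φ z) hz' := by
  apply Subtype.ext
  ext1 v
  obtain ⟨v, rfl⟩ := φ.surjective v
  rw [orthGroupCongr_apply, reflectionIn_apply, reflectionIn_apply, map_sub, map_smul,
    polar_similitude hφ, hφ]
  congr 2
  field_simp

end Congr

/-! ### The decomposition defined by a frame -/

section Frame

open QuadraticMap

variable {F V : Type*} [Field F] [AddCommGroup V] [Module F V] {Q : QuadraticForm F V} {z e f : V}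

theorem mem_frameSpace_left (z e f : V) : z ∈ frameSpace F z e f :=
  Submodule.subset_span (by simp)

theorem mem_frameSpace_mid (z e f : V) : e ∈ frameSpace F z e f :=
  Submodule.subset_span (by simp)

theorem mem_frameSpace_right (z e f : V) : f ∈ frameSpace F z e f :=
  Submodule.subset_span (by simp)

/-- The orthogonal projection onto `⟨z, e, f⟩`. -/
noncomputable def frameProj (Q : QuadraticForm F V) (z e f : V) : V →ₗ[F] frameSpace F z e f :=
  ((2 * Q z)⁻¹ • Q.polarBilin z).smulRight ⟨z, mem_frameSpace_left z e f⟩ +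
    (Q.polarBilin f).smulRight ⟨e, mem_frameSpace_mid z e f⟩ +
    (Q.polarBilin e).smulRight ⟨f, mem_frameSpace_right z e f⟩

theorem coe_frameProj (Q : QuadraticForm F V) (z e f v : V) :
    (frameProj Q z e f v : V) =
      ((2 * Q z)⁻¹ * polar Q z v) • z + polar Q f v • e + polar Q e v • f := rfl

theorem polar_self_eq_two_mul (Q : QuadraticForm F V) (v : V) : polar Q v v = 2 * Q v := by
  rw [polar_self, two_nsmul, two_mul]

namespace IsFrame

theorem polar_ee (h : IsFrame Q z e f) : polar Q e e = 0 := by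
  rw [polar_self, h.e_singular, smul_zero]

theorem polar_ff (h : IsFrame Q z e f) : polar Q f f = 0 := by
  rw [polar_self, h.f_singular, smul_zero]

theorem polar_fe (h : IsFrame Q z e f) : polar Q f e = 1 := by
  rw [polar_comm, h.hyperbolic]

theorem polar_ez (h : IsFrame Q z e f) : polar Q e z = 0 := by
  rw [polar_comm, h.orth_e]

theorem polar_fz (h : IsFrame Q z e f) : polar Q f z = 0 := by
  rw [polar_comm, h.orth_f]

theorem apply_combination (h : IsFrame Q z e f) (a b c : F) :
    Q (a • z + b • e + c • f) = Q z * a ^ 2 + b * c := by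
  simp only [QuadraticMap.map_add Q, QuadraticMap.map_smul, polar_add_left, polar_smul_left,
    polar_smul_right, h.e_singular, h.f_singular, h.hyperbolic, h.orth_e, h.orth_f, smul_eq_mul]
  ring

theorem polar_z_combination (h : IsFrame Q z e f) (a b c : F) :
    polar Q z (a • z + b • e + c • f) = 2 * Q z * a := by
  simp only [polar_add_right, polar_smul_right, polar_self_eq_two_mul, h.orth_e, h.orth_f, smul_eq_mul]
  ring

theorem polar_e_combination (h : IsFrame Q z e f) (a b c : F) :
    polar Q e (a • z + b • e + c • f) = c := by
  simp only [polar_add_right, polar_smul_right, h.polar_ez, h.polar_ee, h.hyperbolic, smul_eq_mul]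
  ring

theorem polar_f_combination (h : IsFrame Q z e f) (a b c : F) :
    polar Q f (a • z + b • e + c • f) = b := by
  simp only [polar_add_right, polar_smul_right, h.polar_fz, h.polar_ff, h.polar_fe, smul_eq_mul]
  ring

theorem sub_frameProj_mem (h2 : (2 : F) ≠ 0) (h : IsFrame Q z e f) (v : V) :
    v - frameProj Q z e f v ∈ perp Q (frameSpace F z e f) := by
  have hz := h.nonsingular
  rw [coe_frameProj]
  refine mem_perp_span.2 ?_
  rintro s (rfl | rfl | rfl)
  · rw [polar_sub_right, h.polar_z_combination]
    field_simp
    ring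
  · rw [polar_sub_right, h.polar_e_combination, sub_self]
  · rw [polar_sub_right, h.polar_f_combination, sub_self]

theorem frameProj_of_mem_perp {u : V} (hu : u ∈ perp Q (frameSpace F z e f)) :
    frameProj Q z e f u = 0 := by
  apply Subtype.ext
  rw [coe_frameProj, hu z (mem_frameSpace_left z e f), hu e (mem_frameSpace_mid z e f),
    hu f (mem_frameSpace_right z e f)]
  simp

theorem exists_eq_combination (w : frameSpace F z e f) :
    ∃ a b c : F, (w : V) = a • z + b • e + c • f := by
  obtain ⟨a, b, c, h⟩ := Submodule.mem_span_triple.1 w.2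
  exact ⟨a, b, c, h.symm⟩

theorem frameProj_coe (h2 : (2 : F) ≠ 0) (h : IsFrame Q z e f) (w : frameSpace F z e f) :
    frameProj Q z e f w = w := by
  have hz := h.nonsingular
  obtain ⟨a, b, c, hw⟩ := exists_eq_combination w
  apply Subtype.ext
  rw [coe_frameProj, hw, h.polar_z_combination, h.polar_e_combination, h.polar_f_combination]
  congr 3
  field_simp

theorem map_add_of_mem_perp {W : Submodule F V} {w u : V} (hw : w ∈ W) (hu : u ∈ perp Q W) :
    Q (w + u) = Q w + Q u := by
  rw [QuadraticMap.map_add Q, hu w hw, add_zero]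

theorem map_eq_add (h2 : (2 : F) ≠ 0) (h : IsFrame Q z e f) (v : V) :
    Q v = Q (frameProj Q z e f v : V) + Q (v - frameProj Q z e f v) := by
  rw [← map_add_of_mem_perp (frameProj Q z e f v).2 (h.sub_frameProj_mem h2 v), add_sub_cancel]

theorem polar_coe_left (h2 : (2 : F) ≠ 0) (h : IsFrame Q z e f) (w : frameSpace F z e f) (v : V) :
    polar Q w v = polar Q w (frameProj Q z e f v : V) := by
  have h1 := h.sub_frameProj_mem h2 v w w.2
  rwa [polar_sub_right, sub_eq_zero] at h1

/-! ### The embedding of O(W) in O(V). -/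

/-- `g ⊕ 1`, as a linear map. -/
noncomputable def extLinear (Q : QuadraticForm F V) (z e f : V)
    (g : frameSpace F z e f ≃ₗ[F] frameSpace F z e f) : V →ₗ[F] V :=
  (frameSpace F z e f).subtype.comp (g.toLinearMap.comp (frameProj Q z e f)) +
    (LinearMap.id - (frameSpace F z e f).subtype.comp (frameProj Q z e f))

theorem extLinear_apply (g : frameSpace F z e f ≃ₗ[F] frameSpace F z e f) (v : V) :
    extLinear Q z e f g v =
      (g (frameProj Q z e f v) : V) + (v - (frameProj Q z e f v : V)) := rfl

theorem frameProj_extLinear (h2 : (2 : F) ≠ 0) (h : IsFrame Q z e f)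
    (g : frameSpace F z e f ≃ₗ[F] frameSpace F z e f) (v : V) :
    frameProj Q z e f (extLinear Q z e f g v) = g (frameProj Q z e f v) := by
  rw [extLinear_apply, map_add, h.frameProj_coe h2,
    frameProj_of_mem_perp (h.sub_frameProj_mem h2 v), add_zero]

theorem extLinear_mul (h2 : (2 : F) ≠ 0) (h : IsFrame Q z e f)
    (g k : frameSpace F z e f ≃ₗ[F] frameSpace F z e f) (v : V) :
    extLinear Q z e f (g * k) v = extLinear Q z e f g (extLinear Q z e f k v) := by
  rw [extLinear_apply (g := g), h.frameProj_extLinear h2, extLinear_apply, extLinear_apply,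
    add_sub_cancel_left]
  rfl

theorem extLinear_one (v : V) : extLinear Q z e f 1 v = v := by
  rw [extLinear_apply]
  exact add_sub_cancel _ _

/-- The embedding `g ↦ g ⊕ 1` of `O(W)` into `O(V)`. -/
noncomputable def extOrth (h2 : (2 : F) ≠ 0) (h : IsFrame Q z e f) :
    orthGroup (restrictForm Q (frameSpace F z e f)) →* orthGroup Q where
  toFun g := ⟨LinearEquiv.ofLinearMap (extLinear Q z e f g.1) (extLinear Q z e f g.1⁻¹)
      (by
        ext1 v
        rw [LinearMap.comp_apply, ← h.extLinear_mul h2, mul_inv_cancel, extLinear_one]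
        rfl)
      (by
        ext1 v
        rw [LinearMap.comp_apply, ← h.extLinear_mul h2, inv_mul_cancel, extLinear_one]
        rfl), by
    intro v
    change Q (extLinear Q z e f g.1 v) = Q v
    rw [extLinear_apply, map_add_of_mem_perp (g.1 _).2 (h.sub_frameProj_mem h2 v),
      h.map_eq_add h2 v]
    congr 1
    exact g.2 _⟩
  map_one' := by
    apply Subtype.ext
    ext1 v
    exact extLinear_one v
  map_mul' g k := by
    apply Subtype.ext
    ext1 v
    exact h.extLinear_mul h2 g.1 k.1 v

theorem extOrth_apply (h2 : (2 : F) ≠ 0) (h : IsFrame Q z e f)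
    (g : orthGroup (restrictForm Q (frameSpace F z e f))) (v : V) :
    (h.extOrth h2 g).1 v = (g.1 (frameProj Q z e f v) : V) + (v - (frameProj Q z e f v : V)) := rfl

theorem extOrth_coe (h2 : (2 : F) ≠ 0) (h : IsFrame Q z e f)
    (g : orthGroup (restrictForm Q (frameSpace F z e f))) (w : frameSpace F z e f) :
    (h.extOrth h2 g).1 w = (g.1 w : V) := by
  rw [extOrth_apply, h.frameProj_coe h2, sub_self, add_zero]

theorem extOrth_of_mem_perp (h2 : (2 : F) ≠ 0) (h : IsFrame Q z e f)
    (g : orthGroup (restrictForm Q (frameSpace F z e f))) {u : V}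
    (hu : u ∈ perp Q (frameSpace F z e f)) : (h.extOrth h2 g).1 u = u := by
  rw [extOrth_apply, frameProj_of_mem_perp hu]
  simp

theorem extOrth_injective (h2 : (2 : F) ≠ 0) (h : IsFrame Q z e f) :
    Function.Injective (h.extOrth h2) := by
  intro g k hgk
  apply Subtype.ext
  ext1 w
  apply Subtype.ext
  rw [← h.extOrth_coe h2, ← h.extOrth_coe h2, hgk]

theorem map_extOrth_omegaGroup (h2 : (2 : F) ≠ 0) (h : IsFrame Q z e f) :
    (omegaGroup (restrictForm Q (frameSpace F z e f))).map (h.extOrth h2) = groupB Q z e f := by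
  ext k
  constructor
  · rintro ⟨g, hg, rfl⟩
    exact ⟨g, hg, h.extOrth_coe h2 g, fun u hu => h.extOrth_of_mem_perp h2 g hu⟩
  · rintro ⟨g, hg, hW, hU⟩
    refine ⟨g, hg, ?_⟩
    apply Subtype.ext
    ext1 v
    rw [h.extOrth_apply h2, ← hW, ← hU _ (h.sub_frameProj_mem h2 v), ← map_add, add_sub_cancel]

theorem nonempty_groupB_mulEquiv (h2 : (2 : F) ≠ 0) (h : IsFrame Q z e f) :
    Nonempty (groupB Q z e f ≃* omegaGroup (restrictForm Q (frameSpace F z e f))) :=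
  ⟨(MulEquiv.subgroupCongr (h.map_extOrth_omegaGroup h2)).symm.trans
    (Subgroup.equivMapOfInjective _ _ (h.extOrth_injective h2)).symm⟩

theorem restrictForm_ne_zero (h : IsFrame Q z e f) :
    restrictForm Q (frameSpace F z e f) ⟨z, mem_frameSpace_left z e f⟩ ≠ 0 :=
  h.nonsingular

/-- The reflection in `z` restricted to `⟨z, e, f⟩`. -/
noncomputable abbrev frameReflection (h : IsFrame Q z e f) :
    orthGroup (restrictForm Q (frameSpace F z e f)) :=
  reflectionIn (restrictForm Q (frameSpace F z e f)) ⟨z, mem_frameSpace_left z e f⟩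
    h.restrictForm_ne_zero

theorem extOrth_frameReflection (h2 : (2 : F) ≠ 0) (h : IsFrame Q z e f) :
    h.extOrth h2 h.frameReflection = reflectionIn Q z h.nonsingular := by
  apply Subtype.ext
  ext1 v
  rw [extOrth_apply, frameReflection, reflectionIn_apply, reflectionIn_apply]
  have h1 : polar (restrictForm Q (frameSpace F z e f)) ⟨z, mem_frameSpace_left z e f⟩
      (frameProj Q z e f v) = polar Q z v :=
    (h.polar_coe_left h2 ⟨z, mem_frameSpace_left z e f⟩ v).symm
  rw [h1]
  change (frameProj Q z e f v : V) - ((Q z)⁻¹ * polar Q z v) • z + _ = _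
  abel

/-! ### Traceless matrix coordinates on W. -/

/-- The coordinates with respect to `z, e, f` as a traceless matrix. -/
noncomputable def frameEquiv (h2 : (2 : F) ≠ 0) (h : IsFrame Q z e f) :
    frameSpace F z e f ≃ₗ[F] Traceless F where
  toFun w := Traceless.mk ((2 * Q z)⁻¹ * polar Q z w) (polar Q f w) ((Q z)⁻¹ * polar Q e w)
  map_add' u w := by
    apply Subtype.ext
    ext i j
    fin_cases i <;> fin_cases j <;> simp [Traceless.mk, polar_add_right] <;> ring
  map_smul' c w := by
    apply Subtype.ext
    ext i j
    fin_cases i <;> fin_cases j <;> simp [Traceless.mk, polar_smul_right] <;> ring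
  invFun M := M.1 0 0 • ⟨z, mem_frameSpace_left z e f⟩ + M.1 0 1 • ⟨e, mem_frameSpace_mid z e f⟩ +
    (Q z * M.1 1 0) • ⟨f, mem_frameSpace_right z e f⟩
  left_inv w := by
    have hz := h.nonsingular
    apply Subtype.ext
    conv_rhs => rw [← h.frameProj_coe h2 w, coe_frameProj]
    simp [Traceless.mk, hz]
  right_inv M := by
    have hz := h.nonsingular
    obtain ⟨a, b, c, rfl⟩ := Traceless.exists_eq_mk M
    change Traceless.mk ((2 * Q z)⁻¹ * polar Q z (a • z + b • e + (Q z * c) • f))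
      (polar Q f (a • z + b • e + (Q z * c) • f))
      ((Q z)⁻¹ * polar Q e (a • z + b • e + (Q z * c) • f)) = _
    rw [h.polar_z_combination, h.polar_e_combination, h.polar_f_combination]
    congr 1 <;> field_simp

theorem frameEquiv_apply (h2 : (2 : F) ≠ 0) (h : IsFrame Q z e f) (w : frameSpace F z e f) :
    h.frameEquiv h2 w =
      Traceless.mk ((2 * Q z)⁻¹ * polar Q z w) (polar Q f w) ((Q z)⁻¹ * polar Q e w) := rfl

theorem frameEquiv_z (h2 : (2 : F) ≠ 0) (h : IsFrame Q z e f) :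
    h.frameEquiv h2 ⟨z, mem_frameSpace_left z e f⟩ = Traceless.mk 1 0 0 := by
  have hz := h.nonsingular
  rw [frameEquiv_apply, polar_self_eq_two_mul, h.polar_fz, h.polar_ez, mul_zero,
    inv_mul_cancel₀ (mul_ne_zero h2 hz)]

/-- The factor 1/Q(z) in the lower left coordinate turns Q(z)a² + bc into -Q(z) times a determinant.
A similitude suffices, since scaling a form does not change its orthogonal group. -/
theorem detForm_frameEquiv (h2 : (2 : F) ≠ 0) (h : IsFrame Q z e f) (w : frameSpace F z e f) :
    Traceless.detForm F (h.frameEquiv h2 w) =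
      -(Q z)⁻¹ * restrictForm Q (frameSpace F z e f) w := by
  have hz := h.nonsingular
  obtain ⟨a, b, c, hw⟩ := exists_eq_combination w
  change _ = _ * Q w
  rw [frameEquiv_apply, Traceless.detForm_mk, hw, h.polar_z_combination, h.polar_e_combination,
    h.polar_f_combination, h.apply_combination]
  field_simp

/-- The isomorphism of `O(W)` with the orthogonal group of the determinant form. -/
noncomputable def frameOrthEquiv (h2 : (2 : F) ≠ 0) (h : IsFrame Q z e f) :
    orthGroup (restrictForm Q (frameSpace F z e f)) ≃* orthGroup (Traceless.detForm F) :=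
  orthGroupCongr (h.frameEquiv h2) (neg_ne_zero.2 (inv_ne_zero h.nonsingular))
    (h.detForm_frameEquiv h2)

theorem frameOrthEquiv_apply (h2 : (2 : F) ≠ 0) (h : IsFrame Q z e f)
    (g : orthGroup (restrictForm Q (frameSpace F z e f))) (w : frameSpace F z e f) :
    (h.frameOrthEquiv h2 g).1 (h.frameEquiv h2 w) = h.frameEquiv h2 (g.1 w) :=
  orthGroupCongr_apply _ _ g w

theorem map_omegaGroup_frameOrthEquiv (h2 : (2 : F) ≠ 0) (h : IsFrame Q z e f) :
    (omegaGroup (restrictForm Q (frameSpace F z e f))).map (h.frameOrthEquiv h2).toMonoidHom =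
      omegaGroup (Traceless.detForm F) :=
  map_omegaGroup_orthGroupCongr _ _

theorem frameOrthEquiv_frameReflection (h2 : (2 : F) ≠ 0) (h : IsFrame Q z e f) :
    h.frameOrthEquiv h2 h.frameReflection =
      reflectionIn (Traceless.detForm F) (Traceless.mk 1 0 0) Traceless.detForm_mk_one_ne_zero := by
  have h1 := h.frameEquiv_z h2
  have h3 : Traceless.detForm F (h.frameEquiv h2 ⟨z, mem_frameSpace_left z e f⟩) ≠ 0 := by
    rw [h1]
    exact Traceless.detForm_mk_one_ne_zero
  rw [frameOrthEquiv, frameReflection, orthGroupCongr_reflectionIn _ _ _ h3]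
  congr 1

theorem nonempty_groupB_mulEquiv_psl (h2 : (2 : F) ≠ 0) (h : IsFrame Q z e f) :
    Nonempty (groupB Q z e f ≃* Matrix.ProjectiveSpecialLinearGroup (Fin 2) F) := by
  obtain ⟨φ⟩ := h.nonempty_groupB_mulEquiv h2
  obtain ⟨ψ⟩ := Traceless.nonempty_omegaGroup_detForm_mulEquiv h2
  exact ⟨φ.trans ((Subgroup.equivMapOfInjective _ (h.frameOrthEquiv h2).toMonoidHom
    (h.frameOrthEquiv h2).injective).trans
      ((MulEquiv.subgroupCongr (h.map_omegaGroup_frameOrthEquiv h2)).trans ψ))⟩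

theorem exists_omegaGroup_apply_eq (h2 : (2 : F) ≠ 0) (h : IsFrame Q z e f)
    (w : frameSpace F z e f) :
    ∃ s ∈ omegaGroup (restrictForm Q (frameSpace F z e f)), s.1 w = h.frameReflection.1 w := by
  obtain ⟨t, ht, htw⟩ := Traceless.exists_omegaGroup_apply_eq h2 (h.frameEquiv h2 w)
  rw [← h.map_omegaGroup_frameOrthEquiv h2] at ht
  obtain ⟨s, hs, rfl⟩ := ht
  refine ⟨s, hs, ?_⟩
  apply (h.frameEquiv h2).injective
  rw [← h.frameOrthEquiv_apply h2, ← h.frameOrthEquiv_apply h2, h.frameOrthEquiv_frameReflection]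
  exact htw

/-- Both maps fix the component of v in U, so only its projection to W matters. -/
theorem exists_groupB_apply_eq (h2 : (2 : F) ≠ 0) (h : IsFrame Q z e f) (v : V) :
    ∃ b ∈ groupB Q z e f, b.1 v = (reflectionIn Q z h.nonsingular).1 v := by
  obtain ⟨s, hs, hsv⟩ := h.exists_omegaGroup_apply_eq h2 (frameProj Q z e f v)
  refine ⟨h.extOrth h2 s, ?_, ?_⟩
  · rw [← h.map_extOrth_omegaGroup h2]
    exact Subgroup.mem_map_of_mem _ hs
  · rw [← h.extOrth_frameReflection h2, extOrth_apply, extOrth_apply, hsv]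

theorem false_of_frameReflection_mul_sub_mem (h2 : (2 : F) ≠ 0) (h : IsFrame Q z e f)
    {s : orthGroup (restrictForm Q (frameSpace F z e f))}
    (hs : s ∈ omegaGroup (restrictForm Q (frameSpace F z e f)))
    {P L : Submodule F (frameSpace F z e f)} (hP : 2 ≤ Module.finrank F P) (hLP : L ≤ P)
    (horth : ∀ l ∈ L, ∀ p ∈ P, polar Q (l : V) p = 0)
    (hsub : ∀ p ∈ P, (h.frameReflection * s).1 p - p ∈ L)
    (hani : L = ⊥ → Module.finrank F P = 2 → ∀ p ∈ P, Q (p : V) = 0 → p = 0) : False := by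
  set φ := h.frameEquiv h2
  have hPr : Module.finrank F (P.map (φ : frameSpace F z e f →ₗ[F] Traceless F)) =
      Module.finrank F P := LinearEquiv.finrank_map_eq φ P
  refine Traceless.false_of_reflectionIn_mul_sub_mem h2 (s := h.frameOrthEquiv h2 s)
    (P := P.map (φ : frameSpace F z e f →ₗ[F] Traceless F))
    (L := L.map (φ : frameSpace F z e f →ₗ[F] Traceless F))
    (orthGroupCongr_mem_omegaGroup _ _ hs) (hPr ▸ hP) (Submodule.map_mono hLP) ?_ ?_ ?_
  · rintro _ ⟨l, hl, rfl⟩ _ ⟨p, hp, rfl⟩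
    have h1 := polar_similitude (h.detForm_frameEquiv h2) l p
    refine h1.trans ?_
    rw [mul_eq_zero]
    exact Or.inr (horth l hl p hp)
  · rintro _ ⟨p, hp, rfl⟩
    refine ⟨_, hsub p hp, ?_⟩
    rw [← h.frameOrthEquiv_frameReflection h2, ← map_mul]
    change φ _ = (h.frameOrthEquiv h2 (h.frameReflection * s)).1 (φ p) - φ p
    rw [h.frameOrthEquiv_apply h2, map_sub]
  · rintro hL hrank _ ⟨p, hp, rfl⟩ hp0
    have h1 : L = ⊥ := by
      rwa [Submodule.map_eq_bot_iff] at hL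
    have h3 := (h.detForm_frameEquiv h2 p).symm.trans hp0
    have h4 : Q (p : V) = 0 :=
      (mul_eq_zero.1 h3).resolve_left (neg_ne_zero.2 (inv_ne_zero h.nonsingular))
    rw [hani h1 (hPr ▸ hrank) p hp h4]
    exact map_zero φ

end IsFrame

end Frame

/-! ### Orbits of a subgroup and of its extension by an involution -/

section Orbits

variable {G M : Type*} [Group G] [MulAction G M]

/-- `A = B ∪ Bτ` for an involution `τ ∈ A` normalising `B`, and no element of `τB` fixes a point. -/
structure IsSwap (M : Type*) [MulAction G M] (A B : Subgroup G) (τ : G) : Prop where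
  le : B ≤ A
  mem : τ ∈ A
  mul_self : τ * τ = 1
  conj_mem : ∀ b ∈ B, τ * b * τ ∈ B
  mem_or : ∀ a ∈ A, a ∈ B ∨ a * τ ∈ B
  smul_ne : ∀ b ∈ B, ∀ m : M, (τ * b) • m ≠ m

variable {A B : Subgroup G} {τ : G}

theorem IsSwap.mem_or_exists (h : IsSwap M A B τ) {a : G} (ha : a ∈ A) :
    a ∈ B ∨ ∃ b ∈ B, a = b * τ := by
  rcases h.mem_or a ha with h1 | h1
  · exact Or.inl h1
  · exact Or.inr ⟨_, h1, by rw [mul_assoc, h.mul_self, mul_one]⟩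

namespace IsSwap

theorem smul_ne_smul (h : IsSwap M A B τ) {b b' : G} (hb : b ∈ B) (hb' : b' ∈ B) (m : M) :
    b • m ≠ b' • τ • m := by
  intro e
  -- Multiplied by τ on the left, the chosen element becomes b'⁻¹bτ, which sends τm to b'⁻¹bm = τm.
  apply h.smul_ne (τ * (b'⁻¹ * b) * τ) (h.conj_mem _ (mul_mem (inv_mem hb') hb)) (τ • m)
  have e' : (b'⁻¹ * b) • m = τ • m := by
    rw [mul_smul, e, inv_smul_smul]
  rw [mul_assoc, ← mul_assoc, ← mul_assoc, h.mul_self, one_mul, smul_smul, mul_assoc, h.mul_self,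
    mul_one, e']

theorem disjoint_orbit (h : IsSwap M A B τ) (m : M) :
    Disjoint (MulAction.orbit B m) (MulAction.orbit B (τ • m)) := by
  rw [Set.disjoint_left]
  rintro _ ⟨b, rfl⟩ ⟨b', e⟩
  exact h.smul_ne_smul b.2 b'.2 m e.symm

theorem orbit_eq_union (h : IsSwap M A B τ) (m : M) :
    MulAction.orbit A m = MulAction.orbit B m ∪ MulAction.orbit B (τ • m) := by
  ext x
  constructor
  · rintro ⟨a, rfl⟩
    rcases h.mem_or_exists a.2 with h1 | ⟨b, hb, e⟩
    · exact Or.inl ⟨⟨a, h1⟩, rfl⟩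
    · refine Or.inr ⟨⟨b, hb⟩, ?_⟩
      change b • τ • m = (a : G) • m
      rw [e, mul_smul]
  · rintro (⟨b, rfl⟩ | ⟨b, rfl⟩)
    · exact ⟨⟨b, h.le b.2⟩, rfl⟩
    · exact ⟨⟨b * τ, mul_mem (h.le b.2) h.mem⟩, mul_smul _ _ _⟩

/-- The `B`-invariant sets that `τ` maps to their complements. -/
def halves (M : Type*) [MulAction G M] (B : Subgroup G) (τ : G) : Set (Set M) :=
  {H | (∀ g ∈ B, ∀ m : M, g • m ∈ H ↔ m ∈ H) ∧ ∀ m, τ • m ∈ H ↔ m ∉ H}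

/-- The orbits whose chosen representative lies in `H`. -/
def representedOrbits (A : Subgroup G) (H : Set M) : Set (MulAction.orbitRel.Quotient A M) :=
  {o | o.out ∈ H}

theorem exists_smul_out (m : M) :
    ∃ a ∈ A, a • (⟦m⟧ : MulAction.orbitRel.Quotient A M).out = m := by
  have h1 : (MulAction.orbitRel A M) m (⟦m⟧ : MulAction.orbitRel.Quotient A M).out :=
    Quotient.exact (Quotient.out_eq _).symm
  obtain ⟨a, ha⟩ := MulAction.orbitRel_apply.1 h1
  exact ⟨a, a.2, ha⟩

theorem mk_smul {a : G} (ha : a ∈ A) (m : M) :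
    (⟦a • m⟧ : MulAction.orbitRel.Quotient A M) = ⟦m⟧ :=
  Quotient.sound (MulAction.orbitRel_apply.2 ⟨⟨a, ha⟩, rfl⟩)

/-- A member of `halves` is determined on an A-orbit by whether it contains the representative r:
B-translates of r agree with r, and those of τr disagree. -/
theorem injOn_representedOrbits (h : IsSwap M A B τ) :
    Set.InjOn (representedOrbits A) (halves M B τ) := by
  intro H hH H' hH' e
  ext m
  obtain ⟨a, ha, hm⟩ := exists_smul_out (A := A) m
  have h1 : (⟦m⟧ : MulAction.orbitRel.Quotient A M).out ∈ H ↔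
      (⟦m⟧ : MulAction.orbitRel.Quotient A M).out ∈ H' := Set.ext_iff.1 e ⟦m⟧
  rw [← hm]
  rcases h.mem_or_exists ha with h3 | ⟨b, hb, rfl⟩
  · rw [hH.1 a h3, hH'.1 a h3, h1]
  · rw [mul_smul, hH.1 b hb, hH'.1 b hb, hH.2, hH'.2, h1]

/-- In an A-orbit belonging to s take the B-orbit of the representative, in any other A-orbit the
opposite B-orbit. The biconditional defining the witness encodes both choices. -/
theorem surjOn_representedOrbits (h : IsSwap M A B τ) :
    Set.SurjOn (representedOrbits A) (halves M B τ) Set.univ := by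
  intro s _
  set r : M → M := fun m => (⟦m⟧ : MulAction.orbitRel.Quotient A M).out with hr
  have hra : ∀ a ∈ A, ∀ m, r (a • m) = r m := by
    intro a ha m
    rw [hr]
    exact congrArg Quotient.out (mk_smul ha m)
  refine ⟨{m | (∃ b ∈ B, b • r m = m) ↔ (⟦m⟧ : MulAction.orbitRel.Quotient A M) ∈ s},
    ⟨fun g hg m => ?_, fun m => ?_⟩, ?_⟩
  · rw [Set.mem_ofPred_eq, Set.mem_ofPred_eq, mk_smul (h.le hg), hra g (h.le hg)]
    refine iff_congr ⟨?_, ?_⟩ Iff.rfl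
    · rintro ⟨b, hb, e⟩
      exact ⟨g⁻¹ * b, mul_mem (inv_mem hg) hb, by rw [mul_smul, e, inv_smul_smul]⟩
    · rintro ⟨b, hb, e⟩
      exact ⟨g * b, mul_mem hg hb, by rw [mul_smul, e]⟩
  · rw [Set.mem_ofPred_eq, Set.mem_ofPred_eq, mk_smul h.mem, hra τ h.mem]
    have key : (∃ b ∈ B, b • r m = τ • m) ↔ ¬ ∃ b ∈ B, b • r m = m := by
      constructor
      · rintro ⟨b, hb, e⟩ ⟨b', hb', e'⟩
        apply h.smul_ne_smul (mul_mem hb (inv_mem hb')) (one_mem B) m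
        rw [one_smul, ← e, mul_smul]
        congr 1
        rw [inv_smul_eq_iff, e']
      · intro hn
        obtain ⟨a, ha, hm⟩ := exists_smul_out (A := A) m
        rcases h.mem_or_exists ha with h3 | ⟨b, hb, rfl⟩
        · exact absurd ⟨a, h3, hm⟩ hn
        · refine ⟨τ * b * τ, h.conj_mem b hb, ?_⟩
          conv_rhs => rw [← hm]
          rw [smul_smul, mul_assoc]
    rw [key]
    exact not_iff.symm
  · ext o
    change ((∃ b ∈ B, b • r o.out = o.out) ↔ (⟦o.out⟧ : MulAction.orbitRel.Quotient A M) ∈ s) ↔ _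
    rw [Quotient.out_eq]
    have : ∃ b ∈ B, b • r o.out = o.out := by
      refine ⟨1, one_mem B, ?_⟩
      rw [one_smul, hr]
      exact congrArg Quotient.out (Quotient.out_eq o)
    exact ⟨fun k => k.1 this, fun k => ⟨fun _ => k, fun _ => this⟩⟩

theorem ncard_halves [Finite M] (h : IsSwap M A B τ) :
    (halves M B τ).ncard = 2 ^ Nat.card (MulAction.orbitRel.Quotient A M) := by
  have hbij : Set.BijOn (representedOrbits A) (halves M B τ) Set.univ :=
    ⟨Set.mapsTo_univ _ _, h.injOn_representedOrbits, h.surjOn_representedOrbits⟩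
  have : Finite (MulAction.orbitRel.Quotient A M) := Quotient.finite _
  have := Fintype.ofFinite (MulAction.orbitRel.Quotient A M)
  rw [← hbij.injOn.ncard_image, hbij.image_eq, Set.ncard_univ,
    Nat.card_eq_fintype_card, Nat.card_eq_fintype_card, Fintype.card_set]

end IsSwap

end Orbits

/-! ### The groups `A` and `B` -/

section Groups

open QuadraticMap

variable {F V : Type*} [Field F] [AddCommGroup V] [Module F V] {Q : QuadraticForm F V} {z e f : V}

namespace IsFrame

/-- τ comes from O(W), in which the derived group is normal. -/
theorem conj_mem_groupB (h2 : (2 : F) ≠ 0) (h : IsFrame Q z e f) {b : orthGroup Q}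
    (hb : b ∈ groupB Q z e f) :
    reflectionIn Q z h.nonsingular * b * reflectionIn Q z h.nonsingular ∈ groupB Q z e f := by
  rw [← h.map_extOrth_omegaGroup h2] at hb ⊢
  obtain ⟨s, hs, rfl⟩ := hb
  refine ⟨h.frameReflection * s * h.frameReflection⁻¹, ?_, ?_⟩
  · exact (inferInstance : (commutator (orthGroup (restrictForm Q (frameSpace F z e f)))).Normal
      ).conj_mem s hs _
  · rw [map_mul, map_mul, map_inv, extOrth_frameReflection,
      inv_eq_of_mul_eq_one_left (reflectionIn_mul_self Q h.nonsingular)]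

/-- B ∪ Bτ is closed under products and inverses, because τ normalises B and squares to one. -/
theorem mem_groupB_or_of_mem_groupA (h2 : (2 : F) ≠ 0) (h : IsFrame Q z e f) {a : orthGroup Q}
    (ha : a ∈ groupA Q z e f h.nonsingular) :
    a ∈ groupB Q z e f ∨ a * reflectionIn Q z h.nonsingular ∈ groupB Q z e f := by
  have hτ := reflectionIn_mul_self Q h.nonsingular
  have hc := fun {b} (hb : b ∈ groupB Q z e f) => h.conj_mem_groupB h2 hb
  rw [groupA] at ha
  set τ := reflectionIn Q z h.nonsingular
  induction ha using Subgroup.closure_induction with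
  | mem x hx =>
    rcases hx with rfl | hx
    · exact Or.inr (hτ ▸ one_mem _)
    · exact Or.inl hx
  | one => exact Or.inl (one_mem _)
  | mul x y _ _ hx hy =>
    rcases hx with hx | hx <;> rcases hy with hy | hy
    · exact Or.inl (mul_mem hx hy)
    · exact Or.inr (by rw [mul_assoc]; exact mul_mem hx hy)
    · right
      have := mul_mem hx (hc hy)
      rwa [mul_assoc x, ← mul_assoc τ, ← mul_assoc τ, hτ, one_mul, ← mul_assoc] at this
    · left
      have := mul_mem hx (hc hy)
      rwa [mul_assoc x, ← mul_assoc τ, ← mul_assoc τ, hτ, one_mul, mul_assoc y, hτ, mul_one] at this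
  | inv x _ hx =>
    rcases hx with hx | hx
    · exact Or.inl (inv_mem hx)
    · right
      have := hc (inv_mem hx)
      rwa [mul_inv_rev, ← mul_assoc, mul_inv_cancel, one_mul] at this

theorem groupB_le_groupA (h : IsFrame Q z e f) :
    groupB Q z e f ≤ groupA Q z e f h.nonsingular :=
  fun _ hb => Subgroup.subset_closure (Set.mem_insert_of_mem _ hb)

theorem reflectionIn_mem_groupA (h : IsFrame Q z e f) :
    reflectionIn Q z h.nonsingular ∈ groupA Q z e f h.nonsingular :=
  Subgroup.subset_closure (Set.mem_insert _ _)

end IsFrame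

theorem QPoint.exists_eq_span (p : QPoint Q) : ∃ v : V, v ≠ 0 ∧ p.1 = Submodule.span F {v} := by
  have hp : p.1 ≠ ⊥ := by
    intro h0
    have := p.2.2
    rw [h0, finrank_bot] at this
    exact zero_ne_one this
  obtain ⟨v, hv, hv0⟩ := Submodule.exists_mem_ne_zero_of_ne_bot hp
  have : FiniteDimensional F p.1 := Module.finite_of_finrank_eq_succ p.2.2
  refine ⟨v, hv0, (Submodule.eq_of_le_of_finrank_eq ?_ ?_).symm⟩
  · rwa [Submodule.span_singleton_le_iff_mem]
  · rw [finrank_span_singleton hv0, p.2.2]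

theorem QPoint.smul_eq_smul {g k : orthGroup Q} {p : QPoint Q} {v : V}
    (hp : p.1 = Submodule.span F {v}) (h : g.1 v = k.1 v) : g • p = k • p := by
  apply Subtype.ext
  change p.1.map _ = p.1.map _
  rw [hp, Submodule.map_span, Submodule.map_span, Set.image_singleton, Set.image_singleton]
  exact congrArg (fun x => Submodule.span F {x}) h

namespace IsFrame

theorem exists_groupB_smul_eq (h2 : (2 : F) ≠ 0) (h : IsFrame Q z e f) (p : QPoint Q) :
    ∃ b ∈ groupB Q z e f, b • p = reflectionIn Q z h.nonsingular • p := by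
  obtain ⟨v, -, hp⟩ := p.exists_eq_span
  obtain ⟨b, hb, hbv⟩ := h.exists_groupB_apply_eq h2 v
  exact ⟨b, hb, QPoint.smul_eq_smul hp hbv⟩

theorem orbit_groupA_eq (h2 : (2 : F) ≠ 0) (h : IsFrame Q z e f) (p : QPoint Q) :
    MulAction.orbit (groupA Q z e f h.nonsingular) p = MulAction.orbit (groupB Q z e f) p := by
  apply Set.Subset.antisymm
  · rintro _ ⟨a, rfl⟩
    rcases h.mem_groupB_or_of_mem_groupA h2 a.2 with ha | ha
    · exact ⟨⟨a, ha⟩, rfl⟩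
    · obtain ⟨b, hb, hbp⟩ := h.exists_groupB_smul_eq h2 p
      refine ⟨⟨_, mul_mem ha hb⟩, ?_⟩
      change (_ * b) • p = (a : orthGroup Q) • p
      rw [mul_smul, hbp, smul_smul, mul_assoc, reflectionIn_mul_self, mul_one]
  · rintro _ ⟨b, rfl⟩
    exact ⟨⟨b, h.groupB_le_groupA b.2⟩, rfl⟩

end IsFrame

end Groups

/-! ### Maximals -/

section Maximals

open QuadraticMap

variable {F V : Type*} [Field F] [AddCommGroup V] [Module F V] {Q : QuadraticForm F V} {z e f : V}

theorem ker_frameProj (h2 : (2 : F) ≠ 0) (h : IsFrame Q z e f) :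
    LinearMap.ker (frameProj Q z e f) = perp Q (frameSpace F z e f) := by
  ext u
  constructor
  · intro hu
    have h1 := h.sub_frameProj_mem h2 u
    rwa [LinearMap.mem_ker.1 hu, Submodule.coe_zero, sub_zero] at h1
  · exact fun hu => LinearMap.mem_ker.2 (IsFrame.frameProj_of_mem_perp hu)

theorem IsFrame.finrank_perp_add_three [FiniteDimensional F V] (h2 : (2 : F) ≠ 0)
    (h : IsFrame Q z e f) :
    Module.finrank F (perp Q (frameSpace F z e f)) + 3 = Module.finrank F V := by
  have h1 := finrank_inf_vectorPerp (X := ⊤) h2 Submodule.mem_top h.nonsingular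
  have h3 := finrank_inf_hyperbolic (X := ⊤ ⊓ vectorPerp Q z)
    ⟨h.e_singular, h.f_singular, h.hyperbolic⟩ ⟨Submodule.mem_top, h.orth_e⟩
    ⟨Submodule.mem_top, h.orth_f⟩
  rw [finrank_top] at h1
  rw [perp_frameSpace]
  omega

/-- No isometry in the coset of `B` containing the reflection in `z` fixes a maximal. -/
theorem IsFrame.reflectionIn_mul_smul_ne [Finite F] [FiniteDimensional F V]
    (hF : Odd (Nat.card F)) {d : ℕ} (hV : Module.finrank F V = 2 * d + 1)
    (hQ : IsNondegenerate Q) (h : IsFrame Q z e f) {b : orthGroup Q} (hb : b ∈ groupB Q z e f)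
    (m : QMaximal Q) : (reflectionIn Q z h.nonsingular * b) • m ≠ m := by
  intro hfix
  have h2 := two_ne_zero_of_odd_card hF
  set U := perp Q (frameSpace F z e f) with hU
  have hwitt : wittIndex Q = d := by
    rw [← wittIndex_restrictForm_top]
    exact hQ.nondegenerateOn_top.wittIndex_eq hF d (by rw [finrank_top, hV])
  have hUrank : Module.finrank F U + 3 = Module.finrank F V := h.finrank_perp_add_three h2
  have hUwitt : Module.finrank F U = 2 * (wittIndex (restrictForm Q U) + 1) := h.elliptic.2
  have hm : IsTotallySingular Q m.1 := m.2.1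
  have hmrank : Module.finrank F m.1 = d := m.2.2.trans hwitt
  rw [← h.map_extOrth_omegaGroup h2] at hb
  obtain ⟨s, hs, rfl⟩ := hb
  rw [← h.extOrth_frameReflection h2, ← map_mul] at hfix
  have hmem : ∀ v ∈ m.1, (h.extOrth h2 (h.frameReflection * s)).1 v ∈ m.1 := by
    intro v hv
    have h1 : m.1.map ((h.extOrth h2 (h.frameReflection * s)).1 : V →ₗ[F] V) = m.1 :=
      congrArg Subtype.val hfix
    rw [← h1]
    exact Submodule.mem_map_of_mem (f := ((h.extOrth h2 (h.frameReflection * s)).1 : V →ₗ[F] V)) hv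
  -- The Witt index of U is d - 2, so the projection P of m has dimension at least d - (d - 2) = 2.
  have hK : Module.finrank F ↥(m.1 ⊓ U) ≤ wittIndex (restrictForm Q U) :=
    finrank_le_wittIndex_restrictForm (hm.mono inf_le_left) inf_le_right
  have hPK := finrank_map_add_finrank_inf_ker m.1 (frameProj Q z e f)
  rw [ker_frameProj h2 h, ← hU] at hPK
  refine h.false_of_frameReflection_mul_sub_mem h2 hs
    (P := m.1.map (frameProj Q z e f)) (L := m.1.comap (frameSpace F z e f).subtype)
    (by omega) ?_ ?_ ?_ ?_
  · intro l hl
    exact ⟨l, hl, h.frameProj_coe h2 l⟩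
  · rintro l hl _ ⟨v, hv, rfl⟩
    rw [← h.polar_coe_left h2]
    exact hm.polar_eq_zero hl hv
  -- The isometry fixes the U-component of v, so the difference of v and its image lies in W as well
  -- as in m.
  · rintro _ ⟨v, hv, rfl⟩
    have h1 := sub_mem (hmem v hv) hv
    have h3 : (h.extOrth h2 (h.frameReflection * s)).1 v - v =
        (((h.frameReflection * s).1 (frameProj Q z e f v) - frameProj Q z e f v :
          frameSpace F z e f) : V) := by
      rw [extOrth_apply, Submodule.coe_sub]
      abel
    rw [h3] at h1
    exact h1
  -- When dim P = 2, m ∩ U attains the Witt index of U. If p is singular, so is v - p, which is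
  -- orthogonal to m ∩ U and therefore lies in it by maximality; then p lies in m ∩ W = L = 0.
  · rintro hL hP _ ⟨v, hv, rfl⟩ hQv
    set p := frameProj Q z e f v with hp
    have hu : v - p ∈ U := h.sub_frameProj_mem h2 v
    have hQu : Q (v - p) = 0 := by
      have h1 := h.map_eq_add h2 v
      rw [hm v hv, ← hp, hQv, zero_add] at h1
      exact h1.symm
    have huK : v - p ∈ m.1 ⊓ U := by
      by_contra hcon
      have h1 := finrank_sup_span_singleton hcon
      have h3 : IsTotallySingular Q (m.1 ⊓ U ⊔ Submodule.span F {v - (p : V)}) := by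
        refine (hm.mono inf_le_left).sup_span hQu fun n hn => ?_
        rw [polar_sub_right, hm.polar_eq_zero hn.1 hv, polar_comm Q n, hn.2 p p.2, sub_zero]
      have h4 := finrank_le_wittIndex_restrictForm (X := U) h3 (by
        rw [sup_le_iff, Submodule.span_singleton_le_iff_mem]
        exact ⟨inf_le_right, hu⟩)
      omega
    have hpL : p ∈ m.1.comap (frameSpace F z e f).subtype := by
      have h1 := sub_mem hv huK.1
      rwa [sub_sub_cancel] at h1
    rw [hL] at hpL
    exact hpL

end Maximals

/-! ### Order of the quadric -/

section Order

open QuadraticMap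

variable {F V : Type*} [Field F] [AddCommGroup V] [Module F V] {Q : QuadraticForm F V}

theorem QPoint.apply_eq_zero {p : QPoint Q} {v : V} (hp : p.1 = Submodule.span F {v}) :
    Q v = 0 :=
  p.2.1 v (hp ▸ Submodule.mem_span_singleton_self v)

/-- For singular u and v, Q(u - v) = -β(u, v) ≠ 0, and the reflection in u - v sends u to v. -/
theorem QPoint.exists_smul_eq_of_polar_ne_zero {p q : QPoint Q} {u v : V}
    (hp : p.1 = Submodule.span F {u}) (hq : q.1 = Submodule.span F {v}) (h : polar Q u v ≠ 0) :
    ∃ g : orthGroup Q, g • p = q := by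
  have hu := QPoint.apply_eq_zero hp
  have hv := QPoint.apply_eq_zero hq
  have hQ : Q (u - v) = -polar Q u v := by
    rw [sub_eq_add_neg, QuadraticMap.map_add Q, QuadraticMap.map_neg, hu, hv, polar_neg_right]
    simp
  have hne : Q (u - v) ≠ 0 := by
    rw [hQ]
    exact neg_ne_zero.2 h
  refine ⟨reflectionIn Q (u - v) hne, ?_⟩
  apply Subtype.ext
  change p.1.map _ = q.1
  rw [hp, hq, Submodule.map_span, Set.image_singleton]
  congr 2
  change (reflectionIn Q (u - v) hne).1 u = v
  rw [reflectionIn_apply, hQ, polar_sub_left, polar_self, hu, smul_zero, zero_sub, polar_comm Q v,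
    inv_mul_cancel₀ (neg_ne_zero.2 h), one_smul, sub_sub_cancel]

/-- A vector space is not the union of two proper subspaces, here the perps of u and v. -/
theorem exists_polar_ne_zero_and (hQ : IsNondegenerate Q) {u v : V} (hu : u ≠ 0) (hv : v ≠ 0) :
    ∃ w, polar Q u w ≠ 0 ∧ polar Q v w ≠ 0 := by
  obtain ⟨a, ha⟩ : ∃ a, polar Q u a ≠ 0 := by
    by_contra! hcon
    exact hu (hQ u fun x => by rw [polar_comm, hcon])
  obtain ⟨b, hb⟩ : ∃ b, polar Q v b ≠ 0 := by
    by_contra! hcon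
    exact hv (hQ v fun x => by rw [polar_comm, hcon])
  by_cases hva : polar Q v a = 0
  · by_cases hub : polar Q u b = 0
    · refine ⟨a + b, ?_, ?_⟩
      · rwa [polar_add_right, hub, add_zero]
      · rwa [polar_add_right, hva, zero_add]
    · exact ⟨b, hub, hb⟩
  · exact ⟨a, ha, hva⟩

/-- The orthogonal group is transitive on points. -/
theorem QPoint.exists_smul_eq (hQ : IsNondegenerate Q) (p q : QPoint Q) :
    ∃ g : orthGroup Q, g • p = q := by
  obtain ⟨u, hu0, hp⟩ := p.exists_eq_span
  obtain ⟨v, hv0, hq⟩ := q.exists_eq_span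
  by_cases huv : polar Q u v = 0
  · have hu := QPoint.apply_eq_zero hp
    obtain ⟨x, hux, hvx⟩ := exists_polar_ne_zero_and hQ hu0 hv0
    -- Orthogonal points are joined through a third one: w is a singular vector of ⟨u, x⟩ off the
    -- line of u. It pairs with u and v as x does, because u is singular and orthogonal to v.
    set w := x + (-(Q x / polar Q u x)) • u with hw
    have hQw : Q w = 0 := by
      rw [hw, QuadraticMap.map_add Q, QuadraticMap.map_smul, hu, polar_smul_right, polar_comm Q x u,
        smul_eq_mul, smul_eq_mul]
      field_simp
      ring
    have huw : polar Q u w ≠ 0 := by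
      rwa [hw, polar_add_right, polar_smul_right, polar_self, hu, smul_zero, smul_zero, add_zero]
    have hwv : polar Q w v ≠ 0 := by
      rwa [polar_comm, hw, polar_add_right, polar_smul_right, polar_comm Q v u, huv, smul_zero,
        add_zero]
    have hw0 : w ≠ 0 := by
      intro h0
      rw [h0, polar_zero_right] at huw
      exact huw rfl
    set r : QPoint Q := ⟨Submodule.span F {w}, by
      intro y hy
      obtain ⟨c, rfl⟩ := Submodule.mem_span_singleton.1 hy
      rw [QuadraticMap.map_smul, hQw, smul_zero], finrank_span_singleton hw0⟩ with hr
    obtain ⟨g, hg⟩ := QPoint.exists_smul_eq_of_polar_ne_zero (q := r) hp rfl huw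
    obtain ⟨k, hk⟩ := QPoint.exists_smul_eq_of_polar_ne_zero (p := r) rfl hq hwv
    exact ⟨k * g, by rw [mul_smul, hg, hk]⟩
  · exact QPoint.exists_smul_eq_of_polar_ne_zero hp hq huv

theorem qIncident_smul_iff (g : orthGroup Q) (p : QPoint Q) (m : QMaximal Q) :
    qIncident Q (g • p) (g • m) ↔ qIncident Q p m :=
  Submodule.map_le_map_iff_of_injective (f := (g.1 : V →ₗ[F] V)) g.1.injective p.1 m.1

theorem card_maximals_smul (g : orthGroup Q) (p : QPoint Q) :
    Nat.card {m // qIncident Q p m} = Nat.card {m // qIncident Q (g • p) m} :=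
  Nat.card_congr ((MulAction.toPerm g).subtypeEquiv fun m => (qIncident_smul_iff g p m).symm)

/-- The points on a maximal are its one-dimensional subspaces. -/
def pointsOnEquiv (m : QMaximal Q) :
    {p // qIncident Q p m} ≃ {N : Submodule F m.1 // Module.finrank F N = 1} where
  toFun p := ⟨p.1.1.comap m.1.subtype, by
    rw [← Submodule.finrank_map_subtype_eq, Submodule.map_comap_subtype, inf_eq_right.2 p.2]
    exact p.1.2.2⟩
  invFun N := ⟨⟨N.1.map m.1.subtype, m.2.1.mono (Submodule.map_subtype_le _ _), by
    rw [Submodule.finrank_map_subtype_eq]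
    exact N.2⟩, Submodule.map_subtype_le _ _⟩
  left_inv p := by
    apply Subtype.ext
    apply Subtype.ext
    change (p.1.1.comap m.1.subtype).map m.1.subtype = p.1.1
    rw [Submodule.map_comap_subtype, inf_eq_right.2 p.2]
  right_inv N := by
    apply Subtype.ext
    exact Submodule.comap_map_eq_of_injective m.1.injective_subtype N.1

theorem card_points_eq [FiniteDimensional F V] (m m' : QMaximal Q) :
    Nat.card {p // qIncident Q p m} = Nat.card {p // qIncident Q p m'} := by
  rw [Nat.card_congr (pointsOnEquiv m), Nat.card_congr (pointsOnEquiv m')]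
  have ψ : m.1 ≃ₗ[F] m'.1 := LinearEquiv.ofFinrankEq _ _ (m.2.2.trans m'.2.2.symm)
  refine Nat.card_congr ((Submodule.orderIsoMapComap ψ).toEquiv.subtypeEquiv fun N => ?_)
  have : Module.finrank F (N.map (ψ : m.1 →ₗ[F] m'.1)) = Module.finrank F N :=
    LinearEquiv.finrank_map_eq ψ N
  change _ ↔ Module.finrank F (N.map (ψ : m.1 →ₗ[F] m'.1)) = 1
  rw [this]

theorem QPoint.finite [Finite V] : Finite (QPoint Q) :=
  Finite.of_injective (fun p : QPoint Q => (p.1 : Set V)) fun _ _ h =>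
    Subtype.ext (SetLike.coe_injective h)

theorem QMaximal.finite [Finite V] : Finite (QMaximal Q) :=
  Finite.of_injective (fun p : QMaximal Q => (p.1 : Set V)) fun _ _ h =>
    Subtype.ext (SetLike.coe_injective h)

theorem QMaximal.exists_qIncident (h : 0 < wittIndex Q) (m : QMaximal Q) :
    ∃ p, qIncident Q p m := by
  have hm : m.1 ≠ ⊥ := by
    intro h0
    have := m.2.2
    rw [h0, finrank_bot] at this
    omega
  obtain ⟨v, hv, hv0⟩ := Submodule.exists_mem_ne_zero_of_ne_bot hm
  have hle : Submodule.span F {v} ≤ m.1 := by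
    rwa [Submodule.span_singleton_le_iff_mem]
  exact ⟨⟨Submodule.span F {v}, m.2.1.mono hle, finrank_span_singleton hv0⟩, hle⟩

theorem exists_hasOrder [Finite V] [FiniteDimensional F V] (hQ : IsNondegenerate Q)
    (h : 0 < wittIndex Q) : ∃ s t, HasOrder (qIncident Q) s t := by
  have := QPoint.finite (Q := Q)
  have := QMaximal.finite (Q := Q)
  obtain ⟨N, hN, hrank⟩ := exists_finrank_eq_wittIndex Q
  set m₀ : QMaximal Q := ⟨N, hN, hrank⟩
  obtain ⟨p₀, hp₀⟩ := m₀.exists_qIncident h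
  -- The counts must be positive to have the forms s + 1 and t + 1; this is where a positive Witt
  -- index enters.
  have hs : Nat.card {p // qIncident Q p m₀} ≠ 0 :=
    Nat.card_ne_zero.2 ⟨⟨⟨p₀, hp₀⟩⟩, inferInstance⟩
  have ht : Nat.card {m // qIncident Q p₀ m} ≠ 0 :=
    Nat.card_ne_zero.2 ⟨⟨⟨m₀, hp₀⟩⟩, inferInstance⟩
  obtain ⟨s, hs⟩ := Nat.exists_eq_succ_of_ne_zero hs
  obtain ⟨t, ht⟩ := Nat.exists_eq_succ_of_ne_zero ht
  refine ⟨s, t, fun m => (card_points_eq m m₀).trans hs, fun p => ?_⟩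
  obtain ⟨g, rfl⟩ := QPoint.exists_smul_eq hQ p₀ p
  exact (card_maximals_smul g p₀).symm.trans ht

end Order

/-! ### Hemisystems -/

section Hemisystem

open QuadraticMap

variable {F V : Type*} [Field F] [AddCommGroup V] [Module F V] {Q : QuadraticForm F V} {z e f : V}

/-- With bp = τp, the element g = b⁻¹τ fixes p and maps H to its complement. It therefore matches
the maximals on p outside H with those inside H. -/
theorem IsFrame.isHemisystem_of_mem_halves [Finite V] [FiniteDimensional F V] (h2 : (2 : F) ≠ 0)
    (hQ : IsNondegenerate Q) (hpos : 0 < wittIndex Q) (h : IsFrame Q z e f)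
    {H : Set (QMaximal Q)}
    (hH : H ∈ IsSwap.halves (QMaximal Q) (groupB Q z e f) (reflectionIn Q z h.nonsingular)) :
    IsHemisystem (qIncident Q) H := by
  have := QMaximal.finite (Q := Q)
  obtain ⟨s, t, hst⟩ := exists_hasOrder hQ hpos
  refine ⟨s, t, hst, fun p => ?_⟩
  obtain ⟨b, hb, hbp⟩ := h.exists_groupB_smul_eq h2 p
  set g := b⁻¹ * reflectionIn Q z h.nonsingular with hg
  have hgp : g • p = p := by
    rw [hg, mul_smul, ← hbp, inv_smul_smul]
  have hgH : ∀ m : QMaximal Q, g • m ∈ H ↔ m ∉ H := fun m => by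
    rw [hg, mul_smul, hH.1 _ (inv_mem hb), hH.2]
  have hinc : ∀ m : QMaximal Q, qIncident Q p (g • m) ↔ qIncident Q p m := fun m => by
    conv_lhs => rw [← hgp]
    exact qIncident_smul_iff g p m
  have e : {m // m ∉ H ∧ qIncident Q p m} ≃ {m // m ∈ H ∧ qIncident Q p m} :=
    (MulAction.toPerm g).subtypeEquiv fun m => by
      rw [MulAction.toPerm_apply, hgH, hinc]
  have hcard := Nat.card_congr e
  rw [← hst.2 p, two_mul]
  nth_rewrite 1 [← hcard]
  rw [← Nat.card_sum]
  classical
  refine Nat.card_congr (((Equiv.sumComm _ _).trans ?_))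
  exact (Equiv.sumCongr (Equiv.subtypeEquivRight fun m => and_comm)
    (Equiv.subtypeEquivRight fun m => and_comm)).trans
    ((Equiv.sumCongr (Equiv.subtypeSubtypeEquivSubtypeInter _ (· ∈ H)).symm
      (Equiv.subtypeSubtypeEquivSubtypeInter _ (· ∉ H)).symm).trans
      (Equiv.sumCompl fun m : {m // qIncident Q p m} => m.1 ∈ H))

/-- The action of the orthogonal group by automorphisms of the quadric. -/
def orthToAut (Q : QuadraticForm F V) : orthGroup Q →* incidenceAut (qIncident Q) :=
  ((MulAction.toPermHom (orthGroup Q) (QPoint Q)).prod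
    (MulAction.toPermHom (orthGroup Q) (QMaximal Q))).codRestrict _
    fun g p m => qIncident_smul_iff g p m

theorem IsFrame.exists_perp_ne_zero [FiniteDimensional F V] (h2 : (2 : F) ≠ 0)
    (h : IsFrame Q z e f) (hV : 3 < Module.finrank F V) :
    ∃ u ∈ perp Q (frameSpace F z e f), u ≠ 0 := by
  apply Submodule.exists_mem_ne_zero_of_ne_bot
  intro h0
  have := h.finrank_perp_add_three h2
  rw [h0, finrank_bot] at this
  omega

/-- Fix u ≠ 0 in U. If w in W has Q(w) = -Q(u), then w + u spans a point; its being fixed, together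
with u, forces w to be fixed. Such vectors w span W. -/
theorem IsFrame.eq_one_of_smul_eq [FiniteDimensional F V] (h2 : (2 : F) ≠ 0)
    (h : IsFrame Q z e f) (hV : 3 < Module.finrank F V) {b : orthGroup Q}
    (hb : b ∈ groupB Q z e f) (hfix : ∀ p : QPoint Q, b • p = p) : b = 1 := by
  obtain ⟨u, hu, hu0⟩ := h.exists_perp_ne_zero h2 hV
  rw [← h.map_extOrth_omegaGroup h2] at hb
  obtain ⟨s, -, rfl⟩ := hb
  have hz := h.nonsingular
  have key : ∀ w : frameSpace F z e f, Q (w : V) = -Q u → s.1 w = w := by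
    intro w hw
    have hproj : frameProj Q z e f (w + u) = w := by
      rw [map_add, h.frameProj_coe h2, IsFrame.frameProj_of_mem_perp hu, add_zero]
    have hne : (w : V) + u ≠ 0 := by
      intro h0
      have hw0 : w = 0 := by rw [← hproj, h0, map_zero]
      rw [hw0, Submodule.coe_zero, zero_add] at h0
      exact hu0 h0
    have hQ0 : Q ((w : V) + u) = 0 := by
      rw [IsFrame.map_add_of_mem_perp w.2 hu, hw, neg_add_cancel]
    have h1 : (Submodule.span F {(w : V) + u}).map ((h.extOrth h2 s).1 : V →ₗ[F] V) =
        Submodule.span F {(w : V) + u} := congrArg Subtype.val (hfix ⟨Submodule.span F {(w : V) + u}, by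
      intro y hy
      obtain ⟨c, rfl⟩ := Submodule.mem_span_singleton.1 hy
      rw [QuadraticMap.map_smul, hQ0, smul_zero], finrank_span_singleton hne⟩)
    have h3 : (h.extOrth h2 s).1 ((w : V) + u) ∈ Submodule.span F {(w : V) + u} := by
      have h6 := Submodule.mem_map_of_mem (f := ((h.extOrth h2 s).1 : V →ₗ[F] V))
        (Submodule.mem_span_singleton_self ((w : V) + u))
      rwa [h1] at h6
    obtain ⟨c, hc⟩ := Submodule.mem_span_singleton.1 h3
    rw [map_add, h.extOrth_coe h2, h.extOrth_of_mem_perp h2 s hu, smul_add] at hc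
    -- The two sides lie in U and W, which meet trivially; so both vanish and c = 1.
    have h4 : (c - 1) • u = (((s.1 w - c • w : frameSpace F z e f)) : V) := by
      rw [Submodule.coe_sub, Submodule.coe_smul, sub_smul, one_smul]
      rw [sub_eq_sub_iff_add_eq_add, add_comm, hc]
    have h5 : s.1 w - c • w = 0 := by
      rw [← h.frameProj_coe h2 (s.1 w - c • w), ← h4,
        IsFrame.frameProj_of_mem_perp (Submodule.smul_mem _ _ hu)]
    rw [h5, Submodule.coe_zero, smul_eq_zero] at h4
    have hc1 : c = 1 := sub_eq_zero.1 (h4.resolve_right hu0)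
    rw [hc1, one_smul, sub_eq_zero] at h5
    exact h5
  set z' : frameSpace F z e f := ⟨z, mem_frameSpace_left z e f⟩
  set e' : frameSpace F z e f := ⟨e, mem_frameSpace_mid z e f⟩
  set f' : frameSpace F z e f := ⟨f, mem_frameSpace_right z e f⟩
  -- The coefficient of f is solved from Q(w) = -Q(u). The values a = 1 and a = -1 differ by 2z, and
  -- a = 0 against a = 1 then isolates Q(z)f.
  have hval : ∀ a : F, s.1 (a • z' + (1 : F) • e' + (-Q u - Q z * a ^ 2) • f') =
      a • z' + (1 : F) • e' + (-Q u - Q z * a ^ 2) • f' := by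
    intro a
    apply key
    change Q (a • z + (1 : F) • e + (-Q u - Q z * a ^ 2) • f) = _
    rw [h.apply_combination]
    ring
  have h0 := hval 0
  have h1 := hval 1
  have h3 := hval (-1)
  simp only [map_add, map_smul] at h0 h1 h3
  have hsz : s.1 z' = z' := by
    apply smul_right_injective _ h2
    change (2 : F) • s.1 z' = (2 : F) • z'
    linear_combination (norm := module) h1 - h3
  have hsf : s.1 f' = f' := by
    apply smul_right_injective _ hz
    change Q z • s.1 f' = Q z • f'
    rw [hsz] at h1 h0
    linear_combination (norm := module) h0 - h1
  have hse : s.1 e' = e' := by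
    rw [hsz, hsf] at h0
    simpa using h0
  have hs1 : s = 1 := by
    apply Subtype.ext
    ext1 w
    obtain ⟨a, b, c, hw⟩ := IsFrame.exists_eq_combination w
    have hw' : w = a • z' + b • e' + c • f' := Subtype.ext hw
    rw [hw', map_add, map_add, map_smul, map_smul, map_smul, hsz, hse, hsf]
    rfl
  rw [hs1, map_one]

theorem IsFrame.admits [FiniteDimensional F V] (h2 : (2 : F) ≠ 0)
    (h : IsFrame Q z e f) (hV : 3 < Module.finrank F V) {H : Set (QMaximal Q)}
    (hH : ∀ g ∈ groupB Q z e f, ∀ m : QMaximal Q, g • m ∈ H ↔ m ∈ H) :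
    Admits (qIncident Q) H (groupB Q z e f) := by
  set φ := (orthToAut Q).comp (groupB Q z e f).subtype with hφ
  refine ⟨φ.range, ?_, ⟨MonoidHom.ofInjective (f := φ) ?_⟩⟩
  · rintro _ ⟨b, rfl⟩ m
    exact hH b b.2 m
  · rw [injective_iff_map_eq_one]
    intro b hb
    apply Subtype.ext
    refine h.eq_one_of_smul_eq h2 hV b.2 fun p => ?_
    have h1 := congrArg (fun k : incidenceAut (qIncident Q) => k.1.1 p) hb
    exact h1

end Hemisystem

theorem theorem1 {F V : Type*} [Field F] [Finite F] [AddCommGroup V] [Module F V]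
    (hF : Odd (Nat.card F)) (d : ℕ) (hd : 2 ≤ d) (hV : Module.finrank F V = 2 * d + 1)
    (Q : QuadraticForm F V) (hQ : IsNondegenerate Q) :
    (∃ z e f : V, IsFrame Q z e f) ∧
    ∀ (z e f : V) (h : IsFrame Q z e f),
      Nonempty (groupB Q z e f ≃* omegaGroup (restrictForm Q (frameSpace F z e f))) ∧
      Nonempty (groupB Q z e f ≃* Matrix.ProjectiveSpecialLinearGroup (Fin 2) F) ∧
      (∀ p : QPoint Q, MulAction.orbit (groupA Q z e f h.nonsingular) p =
        MulAction.orbit (groupB Q z e f) p) ∧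
      (∀ m : QMaximal Q, ∃ m₁ m₂ : QMaximal Q,
        Disjoint (MulAction.orbit (groupB Q z e f) m₁) (MulAction.orbit (groupB Q z e f) m₂) ∧
        MulAction.orbit (groupA Q z e f h.nonsingular) m =
          MulAction.orbit (groupB Q z e f) m₁ ∪ MulAction.orbit (groupB Q z e f) m₂) ∧
      ∃ 𝓗 : Set (Set (QMaximal Q)),
        𝓗.ncard = 2 ^ Nat.card
          (MulAction.orbitRel.Quotient (groupA Q z e f h.nonsingular) (QMaximal Q)) ∧
        ∀ H ∈ 𝓗, IsHemisystem (qIncident Q) H ∧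
          (∀ g ∈ groupB Q z e f, ∀ m : QMaximal Q, g • m ∈ H ↔ m ∈ H) ∧
          Admits (qIncident Q) H (groupB Q z e f) := by
  have h2 := two_ne_zero_of_odd_card hF
  have : FiniteDimensional F V := Module.finite_of_finrank_eq_succ hV
  have : Finite V := Module.finite_of_finite F
  have hwitt : wittIndex Q = d := by
    rw [← wittIndex_restrictForm_top]
    exact hQ.nondegenerateOn_top.wittIndex_eq hF d (by rw [finrank_top, hV])
  refine ⟨exists_isFrame hF hd hV hQ, fun z e f h => ?_⟩
  have hswap : IsSwap (QMaximal Q) (groupA Q z e f h.nonsingular) (groupB Q z e f)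
      (reflectionIn Q z h.nonsingular) :=
    { le := h.groupB_le_groupA
      mem := h.reflectionIn_mem_groupA
      mul_self := reflectionIn_mul_self Q h.nonsingular
      conj_mem := fun b hb => h.conj_mem_groupB h2 hb
      mem_or := fun a ha => h.mem_groupB_or_of_mem_groupA h2 ha
      smul_ne := fun b hb m => h.reflectionIn_mul_smul_ne hF hV hQ hb m }
  -- The two B-orbits are those of m and τm.
  refine ⟨h.nonempty_groupB_mulEquiv h2, h.nonempty_groupB_mulEquiv_psl h2, h.orbit_groupA_eq h2,
    fun m => ⟨m, _, hswap.disjoint_orbit m, hswap.orbit_eq_union m⟩, ?_⟩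
  have := QMaximal.finite (Q := Q)
  exact ⟨_, hswap.ncard_halves, fun H hH =>
    ⟨h.isHemisystem_of_mem_halves h2 hQ (by omega) hH, hH.1, h.admits h2 (by omega) hH.1⟩⟩
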